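/- **Setting.** There are $m$ base arms, $[m]=\{1,\dots,m\}$, a non-empty family $\mathcal I\subseteq 2^{[m]}$ of feasible super arms, and a class $\mathcal D$ of distributions $D=D_1\times\dots\times D_m$ on $[0,1]^m$ with independent coordinates. The mean outcome vector of $D$ is $\mu=\mu(D)$, $\mu_i=\mathbb E_{X\sim D}[X_i]$. In each round the learner selects $S\in\mathcal I$; an outcome vector $X\sim D$ is drawn independently of the past; a random set $S'\supseteq S$ of triggered base arms is drawn from $D^{\mathrm{trig}}(S,X)$; the reward is $R(S',X)$, and $(X_i)_{i\in S'}$ is observed. Put $p_i^{D,S}=\Pr(i\in S')$, $\tilde S=\tilde S^D=\{i:p_i^{D,S}>0\}$, and $p^*=p^*(D)=\min\{p_i^{D,S}: i\in[m],\,S\in\mathcal I,\,p_i^{D,S}>0\}$ ($p^*=\infty$, $1/p^*=0$ if this set is empty). **Assumptions.** 1. (Mean reward) There is a function $r$ such that, for all $D\in\mathcal D$ and $S\in\mathcal I$, the reward is integrable and $\mathbb E[R(S',X)]=r(S,\mu(D))$. 2. (Lipschitz continuity) There is $B>0$ such that $|r(S,\mu)-r(S,\mu')|\le B\sum_{i\in\tilde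 S^D}|\mu_i-\mu'_i|$ for all $S\in\mathcal I$, all $D\in\mathcal D$ with mean vector $\mu$, and all $\mu'\in[0,1]^m$. 3. (Monotonicity) $r(S,\mu)\le r(S,\mu')$ for all $S\in\mathcal I$ and all $\mu,\mu'\in[0,1]^m$ with $\mu_i\le\mu_i'$ for every $i$. 4. (Triggering through triggered arms) For all $S\in\mathcal I$ and $A\subseteq[m]$, the probability $D^{\mathrm{trig}}(S,x)(\{A\})$ depends on $x$ only through those $x_i$ with $i\in A$ for which $i$ is binary, i.e. $X_i\in\{0,1\}$ almost surely under every distribution of $\mathcal D$. **Algorithm.** Combinatorial Thompson sampling (CTS) starts with $a_i=b_i=1$ for all $i$. In each round it draws independent $\theta_i\sim\mathrm{Beta}(a_i,b_i)$ and selects $S(t)=\mathrm{Oracle}(\theta)$, where $\mathrm{Oracle}$ is a measurable map with $\mathrm{Oracle}(\theta)\in\arg\max_{S\in\mathcal I}r(S,\theta)$ for all $\theta\in[0,1]^m$. Then, for each triggered arm $i\in S'(t)$, it draws $Y_i\in\{0,1\}$ with $\Pr(Y_i=1\mid X_i)=X_i$ (independently over $i$), and replaces $a_i$ by $a_i+Y_i$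 and $b_i$ by $b_i+1-Y_i$. **Theorem.** Let $D$ be random, with values in $\mathcal D$, such that $\mu=\mu(D)$ is uniformly distributed on $[0,1]^m$. Then, for every horizon $T$ and every $\rho\in(0,1)$, the Bayesian regret of CTS, $$\mathrm{BayReg}(T)=\mathbb E\Big[\sum_{t=1}^T\Big(\max_{S\in\mathcal I}r(S,\mu)-r(S(t),\mu)\Big)\Big],$$ where the expectation is over $D$ and over the run of CTS in the environment $D$, satisfies $$\mathrm{BayReg}(T)\le 4mB\sqrt{\frac{T(2+6\log T)}{1-\rho}}\;\mathbb E\Big[\sqrt{1/p^*}\Big]+8m^2B\Big(1+\frac1{\rho^2}\,\mathbb E\big[1/p^*\big]\Big).$$ (The right-hand side may be infinite. For $T=0$ or $m=0$, where the regret is zero, use the conventions $\log 0=0$ and $0\cdot\infty=0$.) -/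

import Mathlib

open MeasureTheory ProbabilityTheory
open scoped ENNReal unitInterval

noncomputable section

namespace CMAB

/-- The cube `[0,1]^m`: outcome vectors, mean outcome vectors and parameter vectors. -/
abbrev Cube (m : ℕ) : Type := Fin m → I

/-- An outcome distribution on `[0,1]^m` with mutually independent coordinates, given by its
marginals `D_1, …, D_m`; the distribution itself is the product `outcomeLaw D`. -/
abbrev Env (m : ℕ) : Type := Fin m → ProbabilityMeasure I

/-- The product distribution `D = D_1 × ⋯ × D_m` on `[0,1]^m`. -/
def outcomeLaw {m : ℕ} (D : Env m) : Measure (Cube m) :=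
  Measure.pi fun i => (D i : Measure I)

/-- The mean outcome vector `μ` of `D`, `μ_i = E[X_i]`. -/
def meanVec {m : ℕ} (D : Env m) : Cube m := fun i =>
  ⟨∫ x, (x : ℝ) ∂(D i : Measure I), by
    have hint : Integrable (fun x : I => (x : ℝ)) (D i : Measure I) :=
      Integrable.of_bound (by fun_prop) 1
        (Filter.Eventually.of_forall fun x => by
          rw [Real.norm_eq_abs, abs_of_nonneg x.2.1]; exact x.2.2)
    refine ⟨integral_nonneg fun x => x.2.1, ?_⟩
    calc ∫ x, (x : ℝ) ∂(D i : Measure I) ≤ ∫ _x, (1 : ℝ) ∂(D i : Measure I) :=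
          integral_mono hint (integrable_const 1) fun x => x.2.2
      _ = 1 := by simp⟩

/-- A combinatorial multi-armed bandit with probabilistically triggered arms, apart from the true
outcome distribution. The base arms are the elements of `Fin m`. -/
structure Problem (m : ℕ) where
  /-- The class of outcome distributions known to contain the true one. -/
  envs : Set (Env m)
  /-- The feasible super arms. -/
  superArms : Finset (Finset (Fin m))
  superArms_nonempty : superArms.Nonempty
  /-- The probabilistic triggering function: `trig (S, x)` is the law of the set of triggered base
  arms when the super arm `S` is selected and the outcome vector is `x`. -/
  trig : Kernel (Finset (Fin m) × Cube m) (Finset (Fin m))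
  trig_markov : IsMarkovKernel trig
  /-- The base arms of the selected super arm are always triggered. -/
  subset_trig : ∀ S ∈ superArms, ∀ x : Cube m, ∀ᵐ A ∂(trig (S, x)), S ⊆ A
  /-- The reward, a function of the set of triggered base arms and the outcome vector. -/
  reward : Finset (Fin m) → Cube m → ℝ

variable {m : ℕ}

namespace Problem

/-- The joint law of the outcome vector and the set of triggered base arms in a round in which `S`
is selected: `X ∼ D`, then `S' ∼ trig (S, X)`. -/
def playLaw (P : Problem m) (D : Env m) (S : Finset (Fin m)) :
    Measure (Cube m × Finset (Fin m)) :=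
  outcomeLaw D ⊗ₘ P.trig.comap (fun x => (S, x)) measurable_prodMk_left

/-- The triggering probability `p_i^{D,S}`. -/
def trigProb (P : Problem m) (D : Env m) (S : Finset (Fin m)) (i : Fin m) : ℝ≥0∞ :=
  P.playLaw D S {q | i ∈ q.2}

open Classical in
/-- The triggering set `S̃ = {i : p_i^{D,S} > 0}` of the super arm `S`. -/
def triggeringSet (P : Problem m) (D : Env m) (S : Finset (Fin m)) : Finset (Fin m) :=
  {i | 0 < P.trigProb D S i}

/-- The minimum non-zero triggering probability `p_i` of base arm `i` (`∞` if no feasible super arm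
can trigger `i`). -/
def armMinProb (P : Problem m) (D : Env m) (i : Fin m) : ℝ≥0∞ :=
  ⨅ S ∈ P.superArms, ⨅ _ : i ∈ P.triggeringSet D S, P.trigProb D S i

/-- The minimum non-zero triggering probability `p^*`. -/
def minProb (P : Problem m) (D : Env m) : ℝ≥0∞ := ⨅ i, P.armMinProb D i

/-- The expected reward of a super arm depends only on the super arm and on the mean outcome
vector, through the function `r`. -/
def ExpectedReward (P : Problem m) (r : Finset (Fin m) → Cube m → ℝ) : Prop :=
  ∀ D ∈ P.envs, ∀ S ∈ P.superArms,
    Integrable (fun q => P.reward q.2 q.1) (P.playLaw D S) ∧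
      ∫ q, P.reward q.2 q.1 ∂(P.playLaw D S) = r S (meanVec D)

/-- Lipschitz continuity of the expected reward in the `ℓ¹` norm on the triggering set, with
constant `B`. -/
def LipschitzReward (P : Problem m) (r : Finset (Fin m) → Cube m → ℝ) (B : ℝ) : Prop :=
  ∀ S ∈ P.superArms, ∀ D ∈ P.envs, ∀ μ' : Cube m,
    |r S (meanVec D) - r S μ'| ≤
      B * ∑ i ∈ P.triggeringSet D S, |(meanVec D i : ℝ) - (μ' i : ℝ)|

/-- Monotonicity of the expected reward. -/
def MonotoneReward (P : Problem m) (r : Finset (Fin m) → Cube m → ℝ) : Prop :=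
  ∀ S ∈ P.superArms, ∀ μ μ' : Cube m, (∀ i, μ i ≤ μ' i) → r S μ ≤ r S μ'

/-- A base arm is binary if its outcome is `0` or `1` almost surely under every distribution of the
class. -/
def IsBinary (P : Problem m) (i : Fin m) : Prop :=
  ∀ D ∈ P.envs, ∀ᵐ x ∂(D i : Measure I), x = 0 ∨ x = 1

/-- Triggering proceeds through the triggered arms: whether exactly the base arms in `A` get
triggered is influenced by the outcomes of base arms in `A` only, and only by binary ones. -/
def TriggersThroughBinaryArms (P : Problem m) : Prop :=
  ∀ S ∈ P.superArms, ∀ A : Finset (Fin m), ∀ x x' : Cube m,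
    (∀ i ∈ A, P.IsBinary i → x i = x' i) → P.trig (S, x) {A} = P.trig (S, x') {A}

/-- An exact computation oracle: `oracle θ` maximizes `r(·, θ)` over the feasible super arms. -/
structure Oracle (P : Problem m) (r : Finset (Fin m) → Cube m → ℝ) where
  toFun : Cube m → Finset (Fin m)
  measurable_toFun : Measurable toFun
  feasible : ∀ θ, toFun θ ∈ P.superArms
  optimal : ∀ θ, ∀ S ∈ P.superArms, r S θ ≤ r (toFun θ) θ

/-- The suboptimality gap `Δ_S` of `S` under the parameter vector `μ`: the expected reward of an
optimal super arm minus that of `S`. -/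
def gap (P : Problem m) (r : Finset (Fin m) → Cube m → ℝ) (μ : Cube m) (S : Finset (Fin m)) : ℝ :=
  P.superArms.sup' P.superArms_nonempty (fun S' => r S' μ) - r S μ

end Problem

/-! ### Combinatorial Thompson sampling -/

/-- The record `(((θ, X), S'), Y)` of a round: sampled parameter vector, outcome vector, set of
triggered base arms, and the `{0,1}`-valued roundings of the outcomes. -/
abbrev Round (m : ℕ) : Type := ((Cube m × Cube m) × Finset (Fin m)) × (Fin m → Bool)

/-- The sampled parameter vector of a round. -/
def Round.sample (q : Round m) : Cube m := q.1.1.1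

/-- The set of triggered base arms of a round. -/
def Round.triggered (q : Round m) : Finset (Fin m) := q.1.2

/-- The rounded outcomes of a round. -/
def Round.bits (q : Round m) : Fin m → Bool := q.2

/-- The number of past rounds in which base arm `i` was triggered with rounded outcome `1` (first
component) and `0` (second component). -/
def counts {n : ℕ} (h : Fin n → Round m) : Fin m → ℕ × ℕ := fun i =>
  (∑ τ, if i ∈ (h τ).triggered ∧ (h τ).bits i = true then 1 else 0,
   ∑ τ, if i ∈ (h τ).triggered ∧ (h τ).bits i = false then 1 else 0)

lemma measurable_counts {n : ℕ} : Measurable (counts : (Fin n → Round m) → Fin m → ℕ × ℕ) := by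
  have key : ∀ (i : Fin m) (b : Bool), Measurable fun h : Fin n → Round m =>
      ∑ τ, if i ∈ (h τ).triggered ∧ (h τ).bits i = b then 1 else 0 := by
    intro i b
    refine Finset.measurable_sum _ fun τ _ => ?_
    have hm : Measurable fun h : Fin n → Round m => ((h τ).1.2, (h τ).2) := by fun_prop
    exact (Measurable.of_discrete (f := fun q : Finset (Fin m) × (Fin m → Bool) =>
      if i ∈ q.1 ∧ q.2 i = b then (1 : ℕ) else 0)).comp hm
  exact measurable_pi_lambda _ fun i => (key i true).prodMk (key i false)

/-- The Beta distribution with parameters `a`, `b` as a distribution on `[0,1]`. -/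
def betaI (a b : ℝ) : Measure I :=
  (betaMeasure a b).map (Set.projIcc 0 1 zero_le_one)

/-- The law of the sampled parameter vector: independent `θ_i ∼ β(a_i, b_i)`, where
`a_i = 1 + (number of ones)` and `b_i = 1 + (number of zeros)`. -/
def sampleKernel (m : ℕ) : Kernel (Fin m → ℕ × ℕ) (Cube m) :=
  Kernel.ofFunOfCountable fun c =>
    Measure.pi fun i => betaI (1 + ((c i).1 : ℝ)) (1 + ((c i).2 : ℝ))

/-- Independent roundings of the outcomes: `Y_i = 1` with probability `x_i` and `Y_i = 0` with
probability `1 - x_i`. -/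
def roundingKernel (m : ℕ) : Kernel (Cube m) (Fin m → Bool) where
  toFun x := Measure.pi fun i => bernoulliMeasure true false (x i)
  measurable' := by
    refine Measure.measurable_of_measurable_coe _ fun s _ => ?_
    have hs : ∀ x : Cube m, (Measure.pi fun i => bernoulliMeasure true false (x i)) s =
        ∑ y ∈ s.toFinite.toFinset, ∏ i, bernoulliMeasure true false (x i) {y i} := fun x => by
      rw [← Set.Finite.coe_toFinset s.toFinite, ← sum_measure_singleton]
      simp [Measure.pi_singleton]
    simp_rw [hs]
    refine Finset.measurable_sum _ fun y _ => Finset.measurable_prod _ fun i _ => ?_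
    cases y i <;> simp only [bernoulliMeasure_def] <;> simp <;> fun_prop

/-- The law of one round of combinatorial Thompson sampling in the environment `D`, given the counts
of the past rounds: draw `θ` from the Beta distributions and, independently, `X ∼ D`; select
`S = oracle θ`; draw the triggered set `S' ∼ trig (S, X)`; draw the roundings `Y` of `X` (only the
`Y_i` with `i ∈ S'` are ever used). -/
def roundKernel (P : Problem m) {r : Finset (Fin m) → Cube m → ℝ} (O : P.Oracle r) (D : Env m) :
    Kernel (Fin m → ℕ × ℕ) (Round m) :=
  ((sampleKernel m ×ₖ Kernel.const _ (outcomeLaw D)) ⊗ₖ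
      P.trig.comap (fun q : (Fin m → ℕ × ℕ) × (Cube m × Cube m) => (O.toFun q.2.1, q.2.2))
        ((O.measurable_toFun.comp (by fun_prop)).prodMk (by fun_prop))) ⊗ₖ
    (roundingKernel m).comap
      (fun q : (Fin m → ℕ × ℕ) × ((Cube m × Cube m) × Finset (Fin m)) => q.2.1.2)
      (by fun_prop)

/-- The law of the first `n` rounds of combinatorial Thompson sampling in the environment `D`. -/
def historyLaw (P : Problem m) {r : Finset (Fin m) → Cube m → ℝ} (O : P.Oracle r) (D : Env m) :
    (n : ℕ) → Measure (Fin n → Round m)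
  | 0 => Measure.dirac Fin.elim0
  | n + 1 =>
    (historyLaw P O D n ⊗ₘ (roundKernel P O D).comap counts measurable_counts).map
      fun q => Fin.snoc (α := fun _ => Round m) q.1 q.2

/-- The regret of combinatorial Thompson sampling by round `T` in the environment `D`, as the
expectation of the sum of the (non-negative) gaps of the selected super arms. -/
def regret (P : Problem m) {r : Finset (Fin m) → Cube m → ℝ} (O : P.Oracle r) (T : ℕ)
    (D : Env m) : ℝ≥0∞ :=
  ∫⁻ h, ∑ t, ENNReal.ofReal (P.gap r (meanVec D) (O.toFun (h t).sample)) ∂(historyLaw P O D T)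

/-- The Bayesian regret by round `T`: the regret averaged over the random environment. -/
def bayesRegret (P : Problem m) {r : Finset (Fin m) → Cube m → ℝ} (O : P.Oracle r)
    (prior : Measure (Env m)) (T : ℕ) : ℝ≥0∞ :=
  ∫⁻ D, regret P O T D ∂prior

end CMAB

end

noncomputable section

namespace CMAB

variable {m : ℕ}

/-! The argument is posterior sampling. In an environment with mean vector μ, the law of the counts
after n rounds is a factor free of the environment times the Bernoulli likelihood `lik c μ`
(`countsLaw_singleton`); this rests on triggering through binary triggered arms. By conjugacy with
the uniform prior, μ given the counts has the product of Beta laws from which θ is drawn, and θ is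
independent of μ (`lintegral_lintegral_countsLaw`). Hence r(O μ, μ) and r(O θ, θ) have the same
mean, and a round with S = O θ costs at most the mean of |r(S, θ) − r(S, μ)| (`lintegral_gap_le`),
which is at most B times the sum of |θ_i − μ_i| over i ∈ S̃.

Both θ_i and μ_i are close to the empirical mean: after n observations the Beta law puts mass at
most (n + 1) exp(−n s²) beyond distance s (`betaI_tail_le`). With radius √(L/n) and L = 2 + 6 log T,
the exceptional events cost at most 2 per arm over the whole horizon.

The radii remain to be summed over the rounds in which i can be triggered, though it need not be.
Weighting a round by p_i turns the sum of φ(N_i), where N_i counts the observations of i, into the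
expectation of ∑_{k < N_i} φ(k) (`sum_lintegral_trigProb`), and p_i ≥ p*. Treating the whole radius
this way would cost a factor 1/p*. Instead a threshold √L κ is paid in all T rounds, and only the
excess over it is divided by p*; κ = 1/√(p* T) gives 2√(T L / p*) + 1/p*
(`sum_lintegral_radius_le`). The resulting bound is free of ρ and lies below the stated one, since
1/(1 − ρ) and 1/ρ² are at least 1 and m ≤ m². -/

/-! ### Product measures and densities -/

lemma lintegral_pi_prod {ι : Type*} [Fintype ι] {X : ι → Type*} [∀ i, MeasurableSpace (X i)]
    (ν : ∀ i, Measure (X i)) [∀ i, IsProbabilityMeasure (ν i)] {f : ∀ i, X i → ℝ≥0∞}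
    (hf : ∀ i, Measurable (f i)) :
    ∫⁻ x, ∏ i, f i (x i) ∂(Measure.pi ν) = ∏ i, ∫⁻ x, f i x ∂(ν i) := by
  have h := lintegral_prod_eq_prod_lintegral_of_indepFun (μ := Measure.pi ν) Finset.univ
    (fun i x => f i (x i)) (iIndepFun_pi (fun i => (hf i).aemeasurable))
    (fun i => (hf i).comp (measurable_pi_apply i))
  rw [h]
  refine Finset.prod_congr rfl fun i _ => ?_
  exact (measurePreserving_eval ν i).lintegral_comp (hf i)

lemma pi_withDensity {ι : Type*} [Fintype ι] {X : ι → Type*} [∀ i, MeasurableSpace (X i)]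
    (ν : ∀ i, Measure (X i)) [∀ i, IsProbabilityMeasure (ν i)] {f : ∀ i, X i → ℝ≥0∞}
    (hf : ∀ i, Measurable (f i)) [∀ i, SigmaFinite ((ν i).withDensity (f i))] :
    Measure.pi (fun i => (ν i).withDensity (f i)) =
      (Measure.pi ν).withDensity fun x => ∏ i, f i (x i) := by
  refine Measure.pi_eq fun s hs => ?_
  rw [withDensity_apply _ (MeasurableSet.univ_pi hs), ← lintegral_indicator (MeasurableSet.univ_pi hs)]
  have : ∀ x, (Set.univ.pi s).indicator (fun x => ∏ i, f i (x i)) x =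
      ∏ i, (s i).indicator (f i) (x i) := by
    intro x
    by_cases hx : x ∈ Set.univ.pi s
    · rw [Set.indicator_of_mem hx]
      exact Finset.prod_congr rfl fun i _ => (Set.indicator_of_mem (hx i trivial) _).symm
    · rw [Set.indicator_of_notMem hx]
      obtain ⟨i, hi⟩ : ∃ i, x i ∉ s i := by simpa [Set.mem_univ_pi] using hx
      exact (Finset.prod_eq_zero (Finset.mem_univ i) (Set.indicator_of_notMem hi _)).symm
  simp_rw [this]
  rw [lintegral_pi_prod ν fun i => (hf i).indicator (hs i)]
  refine Finset.prod_congr rfl fun i _ => ?_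
  rw [lintegral_indicator (hs i), withDensity_apply _ (hs i)]

/-! ### Beta–Bernoulli conjugacy -/

/-- The likelihood of `c.1` ones and `c.2` zeros under the success probability `x`. -/
def armLik (c : ℕ × ℕ) (x : I) : ℝ≥0∞ :=
  ENNReal.ofReal x ^ c.1 * ENNReal.ofReal (1 - x) ^ c.2

@[fun_prop]
lemma measurable_armLik (c : ℕ × ℕ) : Measurable (armLik c) := by
  unfold armLik; fun_prop

/-- The normalizing constant of the Beta distribution with parameters `1 + c.1`, `1 + c.2`. -/
def armNorm (c : ℕ × ℕ) : ℝ≥0∞ := ENNReal.ofReal (beta (1 + (c.1 : ℝ)) (1 + (c.2 : ℝ)))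

lemma beta_one_add_pos (c : ℕ × ℕ) : 0 < beta (1 + (c.1 : ℝ)) (1 + (c.2 : ℝ)) :=
  beta_pos (by positivity) (by positivity)

lemma armNorm_ne_zero (c : ℕ × ℕ) : armNorm c ≠ 0 := by
  simpa [armNorm] using beta_one_add_pos c

lemma armNorm_ne_top (c : ℕ × ℕ) : armNorm c ≠ ⊤ := ENNReal.ofReal_ne_top

lemma armLik_eq (c : ℕ × ℕ) (x : I) :
    armLik c x = ENNReal.ofReal ((x : ℝ) ^ c.1 * (1 - (x : ℝ)) ^ c.2) := by
  have h1 : 0 ≤ (x : ℝ) := x.2.1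
  have h2 : 0 ≤ 1 - (x : ℝ) := sub_nonneg.2 x.2.2
  rw [armLik, ENNReal.ofReal_mul (by positivity), ENNReal.ofReal_pow h1, ENNReal.ofReal_pow h2]

/-- A density with respect to `volume` on `I` puts the uniform prior and the Beta posterior on the
same space. -/
lemma betaI_eq (c : ℕ × ℕ) :
    betaI (1 + (c.1 : ℝ)) (1 + (c.2 : ℝ)) =
      volume.withDensity fun x : I => (armNorm c)⁻¹ * armLik c x := by
  ext s hs
  have hpdf : Measurable (betaPDF (1 + (c.1 : ℝ)) (1 + (c.2 : ℝ))) :=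
    (measurable_betaPDFReal _ _).ennreal_ofReal
  have hproj : Measurable (Set.projIcc (0 : ℝ) 1 zero_le_one) := continuous_projIcc.measurable
  rw [betaI, Measure.map_apply hproj hs, betaMeasure, withDensity_apply _ (hproj hs),
    withDensity_apply _ hs, ← lintegral_indicator (hproj hs), ← lintegral_indicator hs]
  have h1 : ∫⁻ x : ℝ, (Set.projIcc (0 : ℝ) 1 zero_le_one ⁻¹' s).indicator
        (betaPDF (1 + (c.1 : ℝ)) (1 + (c.2 : ℝ))) x =
      ∫⁻ x in Set.Icc (0 : ℝ) 1, (Set.projIcc (0 : ℝ) 1 zero_le_one ⁻¹' s).indicator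
        (betaPDF (1 + (c.1 : ℝ)) (1 + (c.2 : ℝ))) x := by
    rw [← lintegral_indicator measurableSet_Icc]
    refine lintegral_congr fun x => ?_
    by_cases hx : x ∈ Set.Icc (0 : ℝ) 1
    · rw [Set.indicator_of_mem hx]
    · rw [Set.indicator_of_notMem hx]
      have : betaPDF (1 + (c.1 : ℝ)) (1 + (c.2 : ℝ)) x = 0 := by
        rw [Set.mem_Icc, not_and_or, not_le, not_le] at hx
        rcases hx with hx | hx
        · exact betaPDF_eq_zero_of_nonpos hx.le
        · exact betaPDF_eq_zero_of_one_le hx.le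
      exact Set.indicator_apply_eq_zero.2 fun _ => this
  rw [h1]
  have h2 := unitInterval.measurePreserving_coe.lintegral_comp (hpdf.indicator (hproj hs))
  erw [← h2]
  -- `betaPDF` vanishes at 0 and 1 while `armLik` need not, so the densities agree only almost
  -- everywhere.
  have hne : ∀ a : I, ∀ᵐ x : I, x ≠ a := fun a => by
    simp [ae_iff]
  refine lintegral_congr_ae ?_
  filter_upwards [hne 0, hne 1] with x hx0 hx1
  have hx0' : 0 < (x : ℝ) := lt_of_le_of_ne x.2.1 fun h => hx0 (Subtype.ext h.symm)
  have hx1' : (x : ℝ) < 1 := lt_of_le_of_ne x.2.2 fun h => hx1 (Subtype.ext h)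
  have hmem : (x : ℝ) ∈ (Set.projIcc (0 : ℝ) 1 zero_le_one ⁻¹' s) ↔ x ∈ s := by
    rw [Set.mem_preimage, Set.projIcc_val]
  by_cases hxs : x ∈ s
  · rw [Set.indicator_of_mem hxs, Set.indicator_of_mem (hmem.2 hxs), betaPDF_of_pos_lt_one hx0' hx1', armLik_eq, armNorm,
      ← ENNReal.ofReal_inv_of_pos (beta_one_add_pos c),
      ← ENNReal.ofReal_mul (inv_nonneg.2 (beta_one_add_pos c).le)]
    congr 1
    simp [mul_assoc]
  · rw [Set.indicator_of_notMem hxs, Set.indicator_of_notMem (fun h => hxs (hmem.1 h))]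

instance isProbabilityMeasure_betaI (c : ℕ × ℕ) :
    IsProbabilityMeasure (betaI (1 + (c.1 : ℝ)) (1 + (c.2 : ℝ))) := by
  have : IsProbabilityMeasure (betaMeasure (1 + (c.1 : ℝ)) (1 + (c.2 : ℝ))) :=
    isProbabilityMeasureBeta (by positivity) (by positivity)
  exact Measure.isProbabilityMeasure_map continuous_projIcc.measurable.aemeasurable

/-- The likelihood of the counts `c` under the mean outcome vector `x`. -/
def lik (c : Fin m → ℕ × ℕ) (x : Cube m) : ℝ≥0∞ := ∏ i, armLik (c i) (x i)

/-- The marginal likelihood of the counts `c` under the uniform prior. -/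
def evidence (c : Fin m → ℕ × ℕ) : ℝ≥0∞ := ∏ i, armNorm (c i)

@[fun_prop]
lemma measurable_lik (c : Fin m → ℕ × ℕ) : Measurable (lik c) := by
  unfold lik; fun_prop

lemma sampleKernel_apply (c : Fin m → ℕ × ℕ) :
    sampleKernel m c = Measure.pi fun i => betaI (1 + ((c i).1 : ℝ)) (1 + ((c i).2 : ℝ)) := rfl

instance : IsMarkovKernel (sampleKernel m) :=
  ⟨fun c => by rw [sampleKernel_apply]; infer_instance⟩

lemma sampleKernel_eq_withDensity (c : Fin m → ℕ × ℕ) :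
    sampleKernel m c = (volume : Measure (Cube m)).withDensity fun x => (evidence c)⁻¹ * lik c x := by
  rw [sampleKernel_apply]
  simp_rw [betaI_eq]
  have : ∀ i, SigmaFinite ((volume : Measure I).withDensity
      fun x => (armNorm (c i))⁻¹ * armLik (c i) x) := fun i => by
    rw [← betaI_eq]; infer_instance
  rw [pi_withDensity (fun _ => volume) fun i => by fun_prop]
  congr 1
  ext x
  rw [Finset.prod_mul_distrib, lik, evidence,
    ENNReal.prod_inv_distrib fun i _ j _ _ => Or.inl (armNorm_ne_zero _)]

/-- Bayes' rule: prior times likelihood is evidence times posterior, and the posterior is the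
sampling law of the algorithm. -/
lemma lintegral_lik_mul (c : Fin m → ℕ × ℕ) {F : Cube m → ℝ≥0∞} (hF : Measurable F) :
    ∫⁻ x, lik c x * F x = evidence c * ∫⁻ x, F x ∂(sampleKernel m c) := by
  have h0 : evidence c ≠ 0 := Finset.prod_ne_zero_iff.2 fun i _ => armNorm_ne_zero _
  have h1 : evidence c ≠ ⊤ := ENNReal.prod_ne_top fun i _ => armNorm_ne_top _
  rw [sampleKernel_eq_withDensity, lintegral_withDensity_eq_lintegral_mul _ (by fun_prop) hF]
  simp_rw [Pi.mul_apply, mul_assoc]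
  rw [lintegral_const_mul _ (by fun_prop), ← mul_assoc, ENNReal.mul_inv_cancel h0 h1, one_mul]

/-! ### Concentration of the Beta distribution -/

/-- Put x = cos² α and p = cos² β. The two roots sum to cos(α − β), and |x − p| = |sin(α − β) sin(α
+ β)|, so (x − p)² ≤ 1 − cos²(α − β) ≤ 2(1 − cos(α − β)). -/
lemma sqrt_mul_add_sqrt_mul_le {x p : ℝ} (hx0 : 0 ≤ x) (hx1 : x ≤ 1) (hp0 : 0 ≤ p) (hp1 : p ≤ 1) :
    2 * (√(x * p) + √((1 - x) * (1 - p)) - 1) ≤ -(x - p) ^ 2 := by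
  rw [Real.sqrt_mul hx0, Real.sqrt_mul (sub_nonneg.2 hx1)]
  have ha := Real.sq_sqrt hx0
  have hb := Real.sq_sqrt (sub_nonneg.2 hx1)
  have hc := Real.sq_sqrt hp0
  have hd := Real.sq_sqrt (sub_nonneg.2 hp1)
  set a := √x
  set b := √(1 - x)
  set c := √p
  set d := √(1 - p)
  have e1 : x - p = (a * d - b * c) * (a * d + b * c) := by
    have : (a * d - b * c) * (a * d + b * c) = a ^ 2 * d ^ 2 - b ^ 2 * c ^ 2 := by ring
    rw [this, ha, hb, hc, hd]; ring
  have e2 : (a * d - b * c) ^ 2 + (a * c + b * d) ^ 2 = 1 := by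
    have : (a * d - b * c) ^ 2 + (a * c + b * d) ^ 2 = (a ^ 2 + b ^ 2) * (c ^ 2 + d ^ 2) := by ring
    rw [this, ha, hb, hc, hd]; ring
  have e3 : (a * d + b * c) ^ 2 + (a * c - b * d) ^ 2 = 1 := by
    have : (a * d + b * c) ^ 2 + (a * c - b * d) ^ 2 = (a ^ 2 + b ^ 2) * (c ^ 2 + d ^ 2) := by ring
    rw [this, ha, hb, hc, hd]; ring
  have e4 : (x - p) ^ 2 ≤ (a * d - b * c) ^ 2 := by
    rw [e1, mul_pow]
    exact mul_le_of_le_one_right (sq_nonneg _) (by nlinarith [sq_nonneg (a * c - b * d)])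
  nlinarith [sq_nonneg (1 - (a * c + b * d))]

/-- The inequality x/p ≤ exp(2(√(x/p) − 1)), a form of 1 + y ≤ exp y, is raised to the power k = n
p. Square roots in place of logarithms allow x = 0. -/
lemma pow_le_pow_mul_exp {x p : ℝ} {k n : ℕ} (hx : 0 ≤ x) (hp : 0 ≤ p) (hk : (k : ℝ) = n * p) :
    x ^ k ≤ p ^ k * Real.exp (n * (2 * (√(x * p) - p))) := by
  rcases Nat.eq_zero_or_pos k with rfl | hk0
  · have h : (n : ℝ) * p = 0 := by simpa using hk.symm
    rcases mul_eq_zero.1 h with h | h <;> simp [h]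
  have hp0 : 0 < p := by
    rcases hp.lt_or_eq with h | h
    · exact h
    · rw [← h, mul_zero] at hk
      exact absurd hk (by positivity)
  have h1 : √(x / p) ≤ Real.exp (√(x / p) - 1) := by
    have := Real.add_one_le_exp (√(x / p) - 1); linarith
  have h2 : x ≤ p * Real.exp (2 * (√(x / p) - 1)) := by
    have h3 : x / p ≤ Real.exp (2 * (√(x / p) - 1)) := by
      calc x / p = √(x / p) ^ 2 := (Real.sq_sqrt (by positivity)).symm
        _ ≤ Real.exp (√(x / p) - 1) ^ 2 := by gcongr
        _ = _ := by rw [← Real.exp_nat_mul]; norm_num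
    rw [div_le_iff₀ hp0] at h3
    linarith
  have h4 : p * √(x / p) = √(x * p) := by
    rw [Real.sqrt_div' _ hp, Real.sqrt_mul hx]
    have := Real.mul_self_sqrt hp
    have h5 : √p ≠ 0 := (Real.sqrt_pos.2 hp0).ne'
    field_simp
    rw [Real.sq_sqrt hp]
    ring
  calc x ^ k ≤ (p * Real.exp (2 * (√(x / p) - 1))) ^ k := by gcongr
    _ = p ^ k * Real.exp (n * (2 * (√(x * p) - p))) := by
      rw [mul_pow, ← Real.exp_nat_mul, hk, ← h4]
      congr 2; ring

/-- A Chernoff bound through the Hellinger affinity: the exponents for ones and zeros add up to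
2n(affinity − 1), and the remaining factor is one term of the expansion of (p + (1 − p))^n, hence at
most 1. -/
lemma choose_mul_le_exp (c : ℕ × ℕ) (hn : 0 < c.1 + c.2) {x : ℝ} (hx0 : 0 ≤ x) (hx1 : x ≤ 1) :
    ((c.1 + c.2).choose c.1 : ℝ) * (x ^ c.1 * (1 - x) ^ c.2) ≤
      Real.exp (-((c.1 + c.2 : ℕ) * (x - c.1 / (c.1 + c.2 : ℕ)) ^ 2)) := by
  set n := c.1 + c.2 with hn_def
  have hn' : (0 : ℝ) < n := by exact_mod_cast hn
  set p : ℝ := c.1 / n with hp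
  have hk : (c.1 : ℝ) = n * p := by rw [hp]; field_simp
  have hl : (c.2 : ℝ) = n * (1 - p) := by
    have : (n : ℝ) = c.1 + c.2 := by rw [hn_def]; push_cast; ring
    linarith
  have hp0 : 0 ≤ p := by positivity
  have hp1 : 0 ≤ 1 - p := by
    by_contra! h
    have : (n : ℝ) * (1 - p) < 0 := mul_neg_of_pos_of_neg hn' h
    rw [← hl] at this
    exact absurd this (not_lt.2 (Nat.cast_nonneg _))
  have h1 := pow_le_pow_mul_exp hx0 hp0 hk
  have h2 := pow_le_pow_mul_exp (sub_nonneg.2 hx1) hp1 hl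
  have h3 : ((n.choose c.1 : ℕ) : ℝ) * (p ^ c.1 * (1 - p) ^ c.2) ≤ 1 := by
    have h := add_pow p (1 - p) n
    rw [add_sub_cancel, one_pow] at h
    have h5 := Finset.single_le_sum (f := fun j => p ^ j * (1 - p) ^ (n - j) * (n.choose j : ℝ))
      (fun j _ => by positivity) (Finset.mem_range.2 (by omega : c.1 < n + 1))
    have h6 : n - c.1 = c.2 := by omega
    simp only [h6] at h5
    linarith
  have h4 := sqrt_mul_add_sqrt_mul_le hx0 hx1 hp0 (sub_nonneg.1 hp1)
  calc ((n.choose c.1 : ℕ) : ℝ) * (x ^ c.1 * (1 - x) ^ c.2)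
      ≤ (n.choose c.1 : ℝ) * ((p ^ c.1 * Real.exp (n * (2 * (√(x * p) - p)))) *
        ((1 - p) ^ c.2 * Real.exp (n * (2 * (√((1 - x) * (1 - p)) - (1 - p)))))) := by
        have := sub_nonneg.2 hx1
        gcongr
    _ = ((n.choose c.1 : ℝ) * (p ^ c.1 * (1 - p) ^ c.2)) *
        Real.exp (n * (2 * (√(x * p) + √((1 - x) * (1 - p)) - 1))) := by
        have : (n : ℝ) * (2 * (√(x * p) + √((1 - x) * (1 - p)) - 1)) =
          n * (2 * (√(x * p) - p)) + n * (2 * (√((1 - x) * (1 - p)) - (1 - p))) := by ring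
        rw [this, Real.exp_add]; ring
    _ ≤ 1 * Real.exp (n * (2 * (√(x * p) + √((1 - x) * (1 - p)) - 1))) := by gcongr
    _ ≤ _ := by
      rw [one_mul, Real.exp_le_exp, ← mul_neg]
      gcongr

lemma inv_beta_eq (c : ℕ × ℕ) : (beta (1 + (c.1 : ℝ)) (1 + (c.2 : ℝ)))⁻¹ =
    ((c.1 + c.2 : ℕ) + 1) * ((c.1 + c.2).choose c.1 : ℝ) := by
  have h : (1 + (c.1 : ℝ)) + (1 + (c.2 : ℝ)) = ((c.1 + c.2 + 1 : ℕ) : ℝ) + 1 := by push_cast; ring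
  rw [beta, h, add_comm (1 : ℝ), add_comm (1 : ℝ), Real.Gamma_nat_eq_factorial,
    Real.Gamma_nat_eq_factorial, Real.Gamma_nat_eq_factorial, Nat.factorial_succ,
    ← Nat.choose_mul_factorial_mul_factorial (Nat.le_add_right c.1 c.2), Nat.add_sub_cancel_left]
  push_cast
  field_simp

/-- The empirical mean. -/
def empMean (c : ℕ × ℕ) : ℝ := c.1 / (c.1 + c.2 : ℕ)

/-- By `inv_beta_eq` the Beta density is n + 1 times a binomial probability, which is bounded
pointwise on the tail set. -/
lemma betaI_tail_le (c : ℕ × ℕ) (hn : 0 < c.1 + c.2) {s : ℝ} (hs : 0 ≤ s) :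
    betaI (1 + (c.1 : ℝ)) (1 + (c.2 : ℝ)) {x | s < |(x : ℝ) - empMean c|} ≤
      ENNReal.ofReal (((c.1 + c.2 : ℕ) + 1) * Real.exp (-((c.1 + c.2 : ℕ) * s ^ 2))) := by
  have hmeas : MeasurableSet {x : I | s < |(x : ℝ) - empMean c|} :=
    measurableSet_lt measurable_const (by fun_prop)
  rw [betaI_eq, withDensity_apply _ hmeas]
  calc _ ≤ ∫⁻ x in {x : I | s < |(x : ℝ) - empMean c|},
        ENNReal.ofReal (((c.1 + c.2 : ℕ) + 1) * Real.exp (-((c.1 + c.2 : ℕ) * s ^ 2))) := by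
        refine setLIntegral_mono measurable_const fun x hx => ?_
        rw [armLik_eq, armNorm, ← ENNReal.ofReal_inv_of_pos (beta_one_add_pos c),
          ← ENNReal.ofReal_mul (inv_nonneg.2 (beta_one_add_pos c).le), inv_beta_eq, mul_assoc]
        refine ENNReal.ofReal_le_ofReal (mul_le_mul_of_nonneg_left ?_ (by positivity))
        refine (choose_mul_le_exp c hn x.2.1 x.2.2).trans (Real.exp_le_exp.2 (neg_le_neg ?_))
        refine mul_le_mul_of_nonneg_left ?_ (by positivity)
        rw [← sq_abs ((x : ℝ) - _)]
        exact pow_le_pow_left₀ hs (le_of_lt hx) 2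
    _ ≤ _ := by
      rw [setLIntegral_const]
      exact mul_le_of_le_one_right' prob_le_one

/-! ### Feedback, and the Markov chain of counts -/

/-- The feedback of a round: the triggered set and the rounded outcomes of its arms. -/
abbrev Feedback (m : ℕ) : Type := Finset (Fin m) × (Fin m → Bool)

/-- Restriction of the rounded outcomes to the triggered arms. -/
def mask (A : Finset (Fin m)) (y : Fin m → Bool) : Fin m → Bool := fun i => decide (i ∈ A) && y i

/-- The feedback observed in a round. -/
def Round.feedback (q : Round m) : Feedback m := (q.triggered, mask q.triggered q.bits)

/-- The increment of the counts caused by a feedback. -/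
def increment (o : Feedback m) : Fin m → ℕ × ℕ := fun i =>
  (if i ∈ o.1 ∧ o.2 i = true then 1 else 0, if i ∈ o.1 ∧ o.2 i = false then 1 else 0)

/-- Masking loses nothing, because the counts ignore the bits of untriggered arms. -/
lemma counts_snoc {n : ℕ} (h : Fin n → Round m) (q : Round m) :
    counts (Fin.snoc (α := fun _ => Round m) h q) = counts h + increment q.feedback := by
  ext i
  · simp only [counts, Fin.sum_univ_castSucc, Fin.snoc_castSucc, Fin.snoc_last, Pi.add_apply,
      Prod.fst_add, increment, Round.feedback, mask]
    congr 1
    by_cases hi : i ∈ q.triggered <;> simp [hi]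
  · simp only [counts, Fin.sum_univ_castSucc, Fin.snoc_castSucc, Fin.snoc_last, Pi.add_apply,
      Prod.snd_add, increment, Round.feedback, mask]
    congr 1
    by_cases hi : i ∈ q.triggered <;> simp [hi]

instance (P : Problem m) : IsMarkovKernel P.trig := P.trig_markov

instance (D : Env m) : IsProbabilityMeasure (outcomeLaw D) := by
  unfold outcomeLaw; infer_instance

instance : IsMarkovKernel (roundingKernel m) :=
  ⟨fun x => inferInstanceAs (IsProbabilityMeasure (Measure.pi fun i =>
    bernoulliMeasure true false (x i)))⟩

instance (P : Problem m) (D : Env m) (S : Finset (Fin m)) : IsProbabilityMeasure (P.playLaw D S) := by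
  unfold Problem.playLaw; infer_instance

instance (P : Problem m) {r : Finset (Fin m) → Cube m → ℝ} (O : P.Oracle r) (D : Env m) :
    IsMarkovKernel (roundKernel P O D) := by
  unfold roundKernel; infer_instance

lemma measurable_snoc {n : ℕ} : Measurable fun q : (Fin n → Round m) × Round m =>
    Fin.snoc (α := fun _ => Round m) q.1 q.2 := by
  refine measurable_pi_lambda _ fun t => ?_
  refine Fin.lastCases ?_ (fun t => ?_) t
  · simpa only [Fin.snoc_last] using measurable_snd
  · simp only [Fin.snoc_castSucc]
    exact (measurable_pi_apply t).comp measurable_fst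

instance isProbabilityMeasure_historyLaw (P : Problem m) {r : Finset (Fin m) → Cube m → ℝ}
    (O : P.Oracle r) (D : Env m) (n : ℕ) : IsProbabilityMeasure (historyLaw P O D n) := by
  induction n with
  | zero => unfold historyLaw; infer_instance
  | succ n ih =>
    unfold historyLaw
    exact Measure.isProbabilityMeasure_map measurable_snoc.aemeasurable

/-- The law of the feedback in a round in which `S` is selected. -/
def feedbackLaw (P : Problem m) (D : Env m) (S : Finset (Fin m)) : Measure (Feedback m) :=
  (P.playLaw D S ⊗ₘ (roundingKernel m).comap Prod.fst measurable_fst).map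
    fun q => (q.1.2, mask q.1.2 q.2)

lemma measurable_masked : Measurable fun q : Finset (Fin m) × (Fin m → Bool) => (q.1, mask q.1 q.2) :=
  Measurable.of_discrete

lemma measurable_masked' : Measurable fun q : (Cube m × Finset (Fin m)) × (Fin m → Bool) =>
    (q.1.2, mask q.1.2 q.2) :=
  measurable_masked.comp ((measurable_snd.comp measurable_fst).prodMk measurable_snd)

instance (P : Problem m) (D : Env m) (S : Finset (Fin m)) :
    IsProbabilityMeasure (feedbackLaw P D S) :=
  Measure.isProbabilityMeasure_map measurable_masked'.aemeasurable

lemma lintegral_feedbackLaw (P : Problem m) (D : Env m) (S : Finset (Fin m))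
    (G : Feedback m → ℝ≥0∞) :
    ∫⁻ o, G o ∂(feedbackLaw P D S) = ∫⁻ x, ∫⁻ A, ∫⁻ y, G (A, mask A y) ∂(roundingKernel m x)
      ∂(P.trig (S, x)) ∂(outcomeLaw D) := by
  have hG : Measurable fun q : (Cube m × Finset (Fin m)) × (Fin m → Bool) =>
      G (q.1.2, mask q.1.2 q.2) := (Measurable.of_discrete (f := G)).comp measurable_masked'
  rw [feedbackLaw, lintegral_map .of_discrete measurable_masked',
    Measure.lintegral_compProd hG, Problem.playLaw, Measure.lintegral_compProd]
  · simp only [Kernel.comap_apply]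
  · exact hG.lintegral_kernel_prod_right' (κ := (roundingKernel m).comap Prod.fst measurable_fst)

lemma measurable_feedback : Measurable (Round.feedback : Round m → Feedback m) := by
  have : Measurable fun q : Round m => (q.1.2, q.2) := by fun_prop
  exact measurable_masked.comp this

/-- Only θ and the feedback of a round matter later, and θ influences the feedback only through the
selected super arm. -/
lemma lintegral_roundKernel (P : Problem m) {r : Finset (Fin m) → Cube m → ℝ} (O : P.Oracle r)
    (D : Env m) (c : Fin m → ℕ × ℕ) {G : Cube m × Feedback m → ℝ≥0∞} (hG : Measurable G) :
    ∫⁻ q, G (q.sample, q.feedback) ∂(roundKernel P O D c) =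
      ∫⁻ θ, ∫⁻ o, G (θ, o) ∂(feedbackLaw P D (O.toFun θ)) ∂(sampleKernel m c) := by
  have hs : Measurable (Round.sample : Round m → Cube m) := by unfold Round.sample; fun_prop
  have hG' : Measurable fun q : Round m => G (q.sample, q.feedback) :=
    hG.comp (hs.prodMk measurable_feedback)
  have h2 : Measurable fun q : (Cube m × Cube m) × Finset (Fin m) =>
      ∫⁻ y, G (Round.sample (q, y), Round.feedback (q, y)) ∂(roundingKernel m q.1.2) :=
    hG'.lintegral_kernel_prod_right'
      (κ := (roundingKernel m).comap (fun q : (Cube m × Cube m) × Finset (Fin m) => q.1.2)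
        (by fun_prop))
  have h3 : Measurable fun q : Cube m × Cube m => ∫⁻ A,
      ∫⁻ y, G (Round.sample ((q, A), y), Round.feedback ((q, A), y)) ∂(roundingKernel m q.2)
        ∂(P.trig (O.toFun q.1, q.2)) :=
    h2.lintegral_kernel_prod_right'
      (κ := P.trig.comap (fun q : Cube m × Cube m => (O.toFun q.1, q.2))
        ((O.measurable_toFun.comp (by fun_prop)).prodMk (by fun_prop)))
  rw [roundKernel, Kernel.lintegral_compProd _ _ _ hG', Kernel.lintegral_compProd]
  · simp only [Kernel.comap_apply]
    rw [Kernel.lintegral_prod _ _ _ h3]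
    refine lintegral_congr fun θ => ?_
    rw [lintegral_feedbackLaw, Kernel.const_apply]
    rfl
  · simp only [Kernel.comap_apply]
    exact h2

/-- The law of the counts after `n` rounds. -/
def countsLaw (P : Problem m) {r : Finset (Fin m) → Cube m → ℝ} (O : P.Oracle r) (D : Env m)
    (n : ℕ) : Measure (Fin m → ℕ × ℕ) :=
  (historyLaw P O D n).map counts

instance (P : Problem m) {r : Finset (Fin m) → Cube m → ℝ} (O : P.Oracle r) (D : Env m) (n : ℕ) :
    IsProbabilityMeasure (countsLaw P O D n) :=
  Measure.isProbabilityMeasure_map measurable_counts.aemeasurable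

section

variable (P : Problem m) {r : Finset (Fin m) → Cube m → ℝ} (O : P.Oracle r) (D : Env m)

lemma lintegral_historyLaw_succ {n : ℕ} {F : (Fin (n + 1) → Round m) → ℝ≥0∞} (hF : Measurable F) :
    ∫⁻ h, F h ∂(historyLaw P O D (n + 1)) =
      ∫⁻ h, ∫⁻ q, F (Fin.snoc (α := fun _ => Round m) h q) ∂(roundKernel P O D (counts h))
        ∂(historyLaw P O D n) := by
  rw [historyLaw, lintegral_map hF measurable_snoc]
  exact Measure.lintegral_compProd (hF.comp measurable_snoc)

lemma lintegral_countsLaw (n : ℕ) (F : (Fin m → ℕ × ℕ) → ℝ≥0∞) :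
    ∫⁻ c, F c ∂(countsLaw P O D n) = ∫⁻ h, F (counts h) ∂(historyLaw P O D n) :=
  lintegral_map .of_discrete measurable_counts

lemma countsLaw_zero : countsLaw P O D 0 = Measure.dirac 0 := by
  rw [countsLaw, historyLaw, Measure.map_dirac' measurable_counts]
  congr 1

lemma measurable_oracle_comp {β : Type*} [MeasurableSpace β] (f : Finset (Fin m) → β) :
    Measurable fun θ => f (O.toFun θ) :=
  (Measurable.of_discrete (f := f)).comp O.measurable_toFun

/-- The counts form a Markov chain, since the algorithm reads the past only through them. -/
lemma lintegral_countsLaw_succ (n : ℕ) (F : (Fin m → ℕ × ℕ) → ℝ≥0∞) :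
    ∫⁻ c, F c ∂(countsLaw P O D (n + 1)) =
      ∫⁻ c, ∫⁻ θ, ∫⁻ o, F (c + increment o) ∂(feedbackLaw P D (O.toFun θ)) ∂(sampleKernel m c)
        ∂(countsLaw P O D n) := by
  rw [lintegral_countsLaw, lintegral_countsLaw, lintegral_historyLaw_succ P O D
    (F := fun h => F (counts h)) ((Measurable.of_discrete (f := F)).comp measurable_counts)]
  refine lintegral_congr fun h => ?_
  simp_rw [counts_snoc]
  exact lintegral_roundKernel P O D (counts h) (G := fun q => F (counts h + increment q.2))
    ((Measurable.of_discrete (f := fun o => F (counts h + increment o))).comp measurable_snd)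

lemma lintegral_sum_sample (T : ℕ) {f : Cube m → ℝ≥0∞} (hf : Measurable f) :
    ∫⁻ h, ∑ t, f (h t).sample ∂(historyLaw P O D T) =
      ∑ t ∈ Finset.range T, ∫⁻ c, ∫⁻ θ, f θ ∂(sampleKernel m c) ∂(countsLaw P O D t) := by
  have hs : Measurable (Round.sample : Round m → Cube m) := by unfold Round.sample; fun_prop
  induction T with
  | zero => simp
  | succ T ih =>
    have hm : ∀ n, Measurable fun h : Fin n → Round m => ∑ t, f (h t).sample := fun n =>
      Finset.measurable_sum _ fun t _ => hf.comp (hs.comp (measurable_pi_apply t))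
    rw [lintegral_historyLaw_succ P O D (hm _), Finset.sum_range_succ, ← ih]
    simp only [Fin.sum_univ_castSucc, Fin.snoc_castSucc, Fin.snoc_last]
    rw [lintegral_countsLaw, ← lintegral_add_left (hm T)]
    refine lintegral_congr fun h => ?_
    rw [lintegral_add_left measurable_const, lintegral_const, measure_univ, mul_one]
    congr 1
    rw [lintegral_roundKernel P O D (counts h) (G := fun q => f q.1) (hf.comp measurable_fst)]
    simp

lemma regret_eq_sum (T : ℕ) :
    regret P O T D = ∑ t ∈ Finset.range T, ∫⁻ c, ∫⁻ θ,
      ENNReal.ofReal (P.gap r (meanVec D) (O.toFun θ)) ∂(sampleKernel m c)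
        ∂(countsLaw P O D t) :=
  lintegral_sum_sample P O D T
    (f := fun θ => ENNReal.ofReal (P.gap r (meanVec D) (O.toFun θ)))
    (measurable_oracle_comp P O fun S => ENNReal.ofReal (P.gap r (meanVec D) S))

lemma trigProb_eq_feedbackLaw (S : Finset (Fin m)) (i : Fin m) :
    P.trigProb D S i = feedbackLaw P D S {o | i ∈ o.1} := by
  rw [feedbackLaw, Measure.map_apply measurable_masked' (.of_discrete), Problem.trigProb]
  have hm : MeasurableSet {q : Cube m × Finset (Fin m) | i ∈ q.2} :=
    measurable_snd (MeasurableSet.of_discrete (s := {A : Finset (Fin m) | i ∈ A}))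
  conv_lhs => rw [← Measure.fst_compProd (P.playLaw D S)
    ((roundingKernel m).comap Prod.fst measurable_fst), Measure.fst_apply hm]
  rfl

end

/-! ### Factorization of the likelihood -/

lemma armLik_add (c d : ℕ × ℕ) (x : I) : armLik (c + d) x = armLik c x * armLik d x := by
  simp only [armLik, Prod.fst_add, Prod.snd_add, pow_add]; ring

lemma lik_add (c d : Fin m → ℕ × ℕ) (x : Cube m) : lik (c + d) x = lik c x * lik d x := by
  simp only [lik, Pi.add_apply, armLik_add, Finset.prod_mul_distrib]

@[simp] lemma armLik_zero (x : I) : armLik 0 x = 1 := by simp [armLik]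

@[simp] lemma lik_zero (x : Cube m) : lik 0 x = 1 := by simp [lik]

lemma roundingKernel_mask (x : Cube m) (o : Feedback m) (ho : ∀ i ∉ o.1, o.2 i = false) :
    roundingKernel m x {y | mask o.1 y = o.2} = lik (increment o) x := by
  have hset : {y | mask o.1 y = o.2} =
      Set.univ.pi fun i => if i ∈ o.1 then {o.2 i} else Set.univ := by
    ext y
    simp only [Set.mem_ofPred_eq, funext_iff, Set.mem_univ_pi, mask]
    refine forall_congr' fun i => ?_
    by_cases hi : i ∈ o.1 <;> simp [hi, ho]
  rw [hset]
  change Measure.pi (fun i => bernoulliMeasure true false (x i)) _ = _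
  rw [Measure.pi_pi, lik]
  refine Finset.prod_congr rfl fun i _ => ?_
  by_cases hi : i ∈ o.1
  · cases hz : o.2 i
    · have : 0 ≤ 1 - (x i : ℝ) := sub_nonneg.2 (x i).2.2
      simp [hi, hz, increment, armLik, bernoulliMeasure_def, ENNReal.ofReal, Real.toNNReal_of_nonneg this]
      rfl
    · have : 0 ≤ (x i : ℝ) := (x i).2.1
      simp [hi, hz, increment, armLik, bernoulliMeasure_def, ENNReal.ofReal, Real.toNNReal_of_nonneg this]
      rfl
  · simp [hi, increment, armLik]

lemma lintegral_armLik_increment (D : Env m) (o : Feedback m) (i : Fin m) :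
    ∫⁻ x, armLik (increment o i) x ∂(D i : Measure I) = armLik (increment o i) (meanVec D i) := by
  have hint : Integrable (fun x : I => (x : ℝ)) (D i : Measure I) :=
    Integrable.of_bound (by fun_prop) 1
      (Filter.Eventually.of_forall fun x => by
        rw [Real.norm_eq_abs, abs_of_nonneg x.2.1]; exact x.2.2)
  have h1 : ∫⁻ x : I, ENNReal.ofReal (x : ℝ) ∂(D i : Measure I) =
      ENNReal.ofReal (meanVec D i : ℝ) :=
    (ofReal_integral_eq_lintegral_ofReal hint (Filter.Eventually.of_forall fun x => x.2.1)).symm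
  have h2 : ∫⁻ x : I, ENNReal.ofReal (1 - (x : ℝ)) ∂(D i : Measure I) =
      ENNReal.ofReal (1 - (meanVec D i : ℝ)) := by
    rw [← ofReal_integral_eq_lintegral_ofReal (f := fun x : I => 1 - (x : ℝ))
      ((integrable_const _).sub hint) (Filter.Eventually.of_forall fun x => sub_nonneg.2 x.2.2),
      integral_sub (integrable_const _) hint]
    simp [meanVec]
  by_cases hi : i ∈ o.1
  · cases hz : o.2 i
    · simpa [hi, hz, increment, armLik] using h2
    · simpa [hi, hz, increment, armLik] using h1
  · simp [hi, increment, armLik]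

/-- Each arm contributes at most one factor x_i or 1 − x_i, so the likelihood is affine in every
coordinate, and independence lets the means replace the outcomes. -/
lemma lintegral_lik_increment (D : Env m) (o : Feedback m) :
    ∫⁻ x, lik (increment o) x ∂(outcomeLaw D) = lik (increment o) (meanVec D) := by
  unfold lik outcomeLaw
  rw [lintegral_pi_prod (fun i => (D i : Measure I)) fun i => measurable_armLik _]
  simp_rw [lintegral_armLik_increment]

/-- The outcome vector with the given bits. -/
def bitCube (z : Fin m → Bool) : Cube m := fun i => if z i then 1 else 0

open Classical in
/-- The factor of the likelihood of a feedback which does not depend on the environment. -/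
def feedbackWeight (P : Problem m) (S : Finset (Fin m)) (o : Feedback m) : ℝ≥0∞ :=
  if ∀ i ∉ o.1, o.2 i = false then P.trig (S, bitCube o.2) {o.1} else 0

/-- Either every binary triggered arm has the outcome recorded by its bit, and the triggering
hypothesis applies, or one has the opposite outcome and the likelihood vanishes. -/
lemma trig_mul_lik_eq (P : Problem m) (h_trig : P.TriggersThroughBinaryArms)
    {S : Finset (Fin m)} (hS : S ∈ P.superArms) (o : Feedback m) {x : Cube m}
    (hx : ∀ i, P.IsBinary i → x i = 0 ∨ x i = 1) :
    P.trig (S, x) {o.1} * lik (increment o) x =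
      P.trig (S, bitCube o.2) {o.1} * lik (increment o) x := by
  by_cases h : ∀ i ∈ o.1, P.IsBinary i → x i = bitCube o.2 i
  · rw [h_trig S hS o.1 x _ h]
  · push Not at h
    obtain ⟨i, hi, hb, hne⟩ := h
    have : lik (increment o) x = 0 := by
      refine Finset.prod_eq_zero (Finset.mem_univ i) ?_
      rcases hx i hb with h0 | h0 <;> cases hz : o.2 i <;>
        simp_all [bitCube, armLik, increment]
    rw [this, mul_zero, mul_zero]

lemma feedbackLaw_singleton (P : Problem m) (h_trig : P.TriggersThroughBinaryArms) {D : Env m}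
    (hD : D ∈ P.envs) {S : Finset (Fin m)} (hS : S ∈ P.superArms) (o : Feedback m) :
    feedbackLaw P D S {o} = feedbackWeight P S o * lik (increment o) (meanVec D) := by
  have h1 : feedbackLaw P D S {o} =
      ∫⁻ x, P.trig (S, x) {o.1} * roundingKernel m x {y | mask o.1 y = o.2} ∂(outcomeLaw D) := by
    rw [← lintegral_indicator_one (MeasurableSet.of_discrete), lintegral_feedbackLaw]
    refine lintegral_congr fun x => ?_
    have h2 : ∀ A, ∫⁻ y, ({o} : Set (Feedback m)).indicator 1 (A, mask A y) ∂(roundingKernel m x) =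
        ({o.1} : Set (Finset (Fin m))).indicator
          (fun _ => roundingKernel m x {y | mask o.1 y = o.2}) A := by
      intro A
      by_cases hA : A = o.1
      · subst hA
        rw [Set.indicator_of_mem (Set.mem_singleton _),
          ← lintegral_indicator_one (MeasurableSet.of_discrete)]
        refine lintegral_congr fun y => ?_
        simp [Set.indicator_apply, Prod.ext_iff]
      · rw [Set.indicator_of_notMem (by simpa using hA)]
        simp [Prod.ext_iff, hA]
    simp_rw [h2]
    rw [lintegral_indicator_const (MeasurableSet.of_discrete), mul_comm]
  rw [h1, feedbackWeight]
  split_ifs with ho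
  · simp_rw [roundingKernel_mask _ o ho]
    rw [← lintegral_lik_increment, ← lintegral_const_mul _ (measurable_lik _)]
    refine lintegral_congr_ae ?_
    have hbin : ∀ᵐ x ∂(outcomeLaw D), ∀ i, P.IsBinary i → x i = 0 ∨ x i = 1 := by
      refine ae_all_iff.2 fun i => ?_
      by_cases hi : P.IsBinary i
      · filter_upwards [(measurePreserving_eval (fun i => (D i : Measure I)) i).quasiMeasurePreserving.ae
          (hi D hD)] with x hx _ using hx
      · exact Filter.Eventually.of_forall fun x h => absurd h hi
    filter_upwards [hbin] with x hx using trig_mul_lik_eq P h_trig hS o hx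
  -- A feedback with a nonzero bit outside its triggered set is never produced by `mask`.
  · have h3 : {y | mask o.1 y = o.2} = ∅ := by
      push Not at ho
      obtain ⟨i, hi, hz⟩ := ho
      refine Set.eq_empty_of_forall_notMem fun y hy => hz ?_
      rw [← congrFun hy i]
      simp [mask, hi]
    simp [h3]

section

variable (P : Problem m) {r : Finset (Fin m) → Cube m → ℝ} (O : P.Oracle r)

open Classical in
/-- The factor of the probability of the counts which does not depend on the environment. -/
def countsWeight : ℕ → (Fin m → ℕ × ℕ) → ℝ≥0∞
  | 0, c => if c = 0 then 1 else 0
  | n + 1, c' => ∑' c, countsWeight n c * ∑ o : Feedback m, if c + increment o = c' then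
      ∫⁻ θ, feedbackWeight P (O.toFun θ) o ∂(sampleKernel m c) else 0

/-- Given the counts, the choice of super arm does not depend on the environment. The environment
enters each round through the feedback likelihood alone, and these likelihoods multiply along the
history. -/
lemma countsLaw_singleton (h_trig : P.TriggersThroughBinaryArms) {D : Env m} (hD : D ∈ P.envs)
    (n : ℕ) (c : Fin m → ℕ × ℕ) :
    countsLaw P O D n {c} = countsWeight P O n c * lik c (meanVec D) := by
  classical
  induction n generalizing c with
  | zero =>
    rw [countsLaw_zero, countsWeight, Measure.dirac_apply' _ (.of_discrete)]
    by_cases hc : c = 0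
    · simp [hc]
    · simp [hc, eq_comm]
  | succ n ih =>
    rw [← lintegral_indicator_one (MeasurableSet.of_discrete), lintegral_countsLaw_succ,
      lintegral_countable', countsWeight, ← ENNReal.tsum_mul_right]
    refine tsum_congr fun d => ?_
    rw [ih]
    have h1 : ∀ θ, ∫⁻ o, ({c} : Set (Fin m → ℕ × ℕ)).indicator 1 (d + increment o)
        ∂(feedbackLaw P D (O.toFun θ)) = ∑ o : Feedback m, if d + increment o = c then
          feedbackWeight P (O.toFun θ) o * lik (increment o) (meanVec D) else 0 := by
      intro θ
      rw [lintegral_fintype]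
      refine Finset.sum_congr rfl fun o _ => ?_
      rw [feedbackLaw_singleton P h_trig hD (O.feasible θ)]
      simp [Set.indicator_apply]
    simp_rw [h1]
    rw [lintegral_finsetSum]
    · rw [Finset.sum_mul, Finset.mul_sum, Finset.sum_mul]
      refine Finset.sum_congr rfl fun o _ => ?_
      split_ifs with ho
      · rw [lintegral_mul_const _ (measurable_oracle_comp P O fun S => feedbackWeight P S o), ← ho,
          lik_add]
        ring
      · simp
    · intro o _
      exact measurable_oracle_comp P O fun S => if d + increment o = c then
          feedbackWeight P S o * lik (increment o) (meanVec D) else 0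

lemma increment_le_one (o : Feedback m) (i : Fin m) :
    (increment o i).1 + (increment o i).2 = if i ∈ o.1 then 1 else 0 := by
  by_cases hi : i ∈ o.1
  · cases hz : o.2 i <;> simp [increment, hi, hz]
  · simp [increment, hi]

lemma le_of_countsWeight_ne_zero {n : ℕ} {c : Fin m → ℕ × ℕ} (h : countsWeight P O n c ≠ 0)
    (i : Fin m) : (c i).1 + (c i).2 ≤ n := by
  classical
  induction n generalizing c with
  | zero =>
    have : c = 0 := by
      by_contra hc
      exact h (by simp [countsWeight, hc])
    simp [this]
  | succ n ih =>
    rw [countsWeight, Ne, ENNReal.tsum_eq_zero] at h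
    push Not at h
    obtain ⟨d, hd⟩ := h
    have h2 := right_ne_zero_of_mul hd
    obtain ⟨o, -, ho⟩ := Finset.exists_ne_zero_of_sum_ne_zero h2
    have h3 : d + increment o = c := by
      by_contra h; simp [h] at ho
    have h4 := ih (left_ne_zero_of_mul hd)
    have h5 := increment_le_one o i
    rw [← h3]
    simp only [Pi.add_apply, Prod.fst_add, Prod.snd_add]
    split_ifs at h5 <;> omega

end

/-! ### Regularity of the mean reward -/

instance : (volume : Measure I).IsOpenPosMeasure := by
  refine ⟨fun U hU ⟨x, hx⟩ h0 => ?_⟩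
  obtain ⟨ε, hε, hball⟩ := Metric.isOpen_iff.1 hU x hx
  have hx0 := x.2.1
  have hx1 := x.2.2
  let a : I := ⟨max 0 (x - ε / 2), le_max_left _ _, max_le zero_le_one (by linarith)⟩
  let b : I := ⟨min 1 (x + ε / 2), le_min zero_le_one (by linarith), min_le_left _ _⟩
  have hab : (a : ℝ) < b := by
    simp only [a, b]
    rcases max_cases (0 : ℝ) (x - ε / 2) with h | h <;>
      rcases min_cases (1 : ℝ) (x + ε / 2) with h' | h' <;> linarith
  have hsub : Set.Icc a b ⊆ U := by
    intro y hy
    refine hball ?_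
    rw [Metric.mem_ball, Subtype.dist_eq, Real.dist_eq, abs_lt]
    have h1 : (a : ℝ) ≤ y := hy.1
    have h2 : (y : ℝ) ≤ b := hy.2
    have h3 : (x : ℝ) - ε / 2 ≤ a := le_max_right _ _
    have h4 : (b : ℝ) ≤ x + ε / 2 := min_le_right _ _
    constructor <;> linarith
  have h1 := measure_mono_null hsub h0
  rw [unitInterval.volume_Icc, ENNReal.ofReal_eq_zero] at h1
  linarith

section

variable (P : Problem m) {r : Finset (Fin m) → Cube m → ℝ}

/-- A map that is not a.e. measurable has push-forward zero, whereas the cube has volume 1. -/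
lemma aemeasurable_meanVec {prior : Measure (Env m)} (h_uniform : prior.map meanVec = volume) :
    AEMeasurable meanVec prior := by
  by_contra h
  rw [Measure.map_of_not_aemeasurable h] at h_uniform
  have := congrArg (fun ν : Measure (Cube m) => ν Set.univ) h_uniform
  simp at this

lemma exists_meanVec_mem {prior : Measure (Env m)} (h_class : ∀ᵐ D ∂prior, D ∈ P.envs)
    (h_uniform : prior.map meanVec = volume) {U : Set (Cube m)} (hU : IsOpen U)
    (hne : U.Nonempty) : ∃ D ∈ P.envs, meanVec D ∈ U := by
  by_contra! h
  have h1 : prior (meanVec ⁻¹' U) = 0 :=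
    measure_mono_null (fun D hD hmem => h D hmem hD) (ae_iff.1 h_class)
  rw [← Measure.map_apply_of_aemeasurable (aemeasurable_meanVec h_uniform) hU.measurableSet,
    h_uniform] at h1
  exact (hU.measure_pos volume hne).ne' h1

/-- The Lipschitz hypothesis anchors one argument at a mean vector of the class. These are dense,
because the uniform law charges every nonempty open set, so the bound extends to all pairs.
Measurability and boundedness of `r S` follow from it. -/
lemma abs_reward_sub_le {B : ℝ} (hB : 0 < B) (h_lipschitz : P.LipschitzReward r B)
    {prior : Measure (Env m)} (h_class : ∀ᵐ D ∂prior, D ∈ P.envs)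
    (h_uniform : prior.map meanVec = volume) {S : Finset (Fin m)} (hS : S ∈ P.superArms)
    (μ μ' : Cube m) : |r S μ - r S μ'| ≤ B * ∑ i, |(μ i : ℝ) - (μ' i : ℝ)| := by
  refine le_of_forall_pos_le_add fun ε hε => ?_
  have hU : IsOpen {ν : Cube m | ∑ i, |(ν i : ℝ) - (μ i : ℝ)| < ε / (2 * B)} :=
    isOpen_lt (by fun_prop) continuous_const
  obtain ⟨D, hD, hmem⟩ := exists_meanVec_mem P h_class h_uniform hU
    ⟨μ, by simp only [Set.mem_ofPred_eq, sub_self, abs_zero, Finset.sum_const_zero]; positivity⟩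
  have hmem' : ∑ i, |(meanVec D i : ℝ) - (μ i : ℝ)| < ε / (2 * B) := hmem
  have hlip : ∀ ν : Cube m, |r S (meanVec D) - r S ν| ≤ B * ∑ i, |(meanVec D i : ℝ) - (ν i : ℝ)| :=
    fun ν => (h_lipschitz S hS D hD ν).trans (by
      refine mul_le_mul_of_nonneg_left ?_ hB.le
      exact Finset.sum_le_sum_of_subset_of_nonneg (Finset.subset_univ _) fun _ _ _ => abs_nonneg _)
  have h1 := hlip μ
  have h2 := hlip μ'
  have h3 : ∑ i, |(meanVec D i : ℝ) - (μ' i : ℝ)| ≤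
      ∑ i, |(meanVec D i : ℝ) - (μ i : ℝ)| + ∑ i, |(μ i : ℝ) - (μ' i : ℝ)| := by
    rw [← Finset.sum_add_distrib]
    exact Finset.sum_le_sum fun i _ => abs_sub_le _ _ _
  have h4 : |r S μ - r S μ'| ≤ |r S (meanVec D) - r S μ| + |r S (meanVec D) - r S μ'| := by
    have := abs_sub_le (r S μ) (r S (meanVec D)) (r S μ')
    rwa [abs_sub_comm (r S μ) (r S (meanVec D))] at this
  have h5 : B * ∑ i, |(meanVec D i : ℝ) - (μ i : ℝ)| ≤ ε / 2 := by
    calc _ ≤ B * (ε / (2 * B)) := by gcongr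
      _ = ε / 2 := by field_simp
  have h6 := mul_le_mul_of_nonneg_left h3 hB.le
  rw [mul_add] at h6
  linarith

lemma measurable_reward {B : ℝ}
    (hlip : ∀ S ∈ P.superArms, ∀ μ μ' : Cube m,
      |r S μ - r S μ'| ≤ B * ∑ i, |(μ i : ℝ) - (μ' i : ℝ)|) (hB : 0 < B)
    {S : Finset (Fin m)} (hS : S ∈ P.superArms) : Measurable (r S) := by
  refine (LipschitzWith.of_dist_le_mul (K := (B * m).toNNReal) fun μ μ' => ?_).continuous.measurable
  rw [Real.dist_eq, Real.coe_toNNReal _ (by positivity)]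
  refine (hlip S hS μ μ').trans ?_
  rw [mul_assoc]
  gcongr
  calc ∑ i, |(μ i : ℝ) - (μ' i : ℝ)| ≤ ∑ _i : Fin m, dist μ μ' := by
        refine Finset.sum_le_sum fun i _ => ?_
        rw [← Real.dist_eq, ← Subtype.dist_eq]
        exact dist_le_pi_dist μ μ' i
    _ = m * dist μ μ' := by simp

lemma exists_abs_reward_le {B : ℝ}
    (hlip : ∀ S ∈ P.superArms, ∀ μ μ' : Cube m,
      |r S μ - r S μ'| ≤ B * ∑ i, |(μ i : ℝ) - (μ' i : ℝ)|) (hB : 0 < B) :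
    ∃ C, ∀ S ∈ P.superArms, ∀ μ, |r S μ| ≤ C := by
  refine ⟨∑ S ∈ P.superArms, |r S 0| + B * m, fun S hS μ => ?_⟩
  have h1 : |r S 0| ≤ ∑ S ∈ P.superArms, |r S 0| :=
    Finset.single_le_sum (f := fun S => |r S 0|) (fun _ _ => abs_nonneg _) hS
  have h2 : ∑ i, |(μ i : ℝ) - ((0 : Cube m) i : ℝ)| ≤ m := by
    calc ∑ i, |(μ i : ℝ) - ((0 : Cube m) i : ℝ)| ≤ ∑ _i : Fin m, (1 : ℝ) := by
          refine Finset.sum_le_sum fun i _ => ?_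
          simp only [Pi.zero_apply, Set.Icc.coe_zero, sub_zero]
          rw [abs_of_nonneg (μ i).2.1]
          exact (μ i).2.2
      _ = m := by simp
  have h3 := hlip S hS μ 0
  have h4 := mul_le_mul_of_nonneg_left h2 hB.le
  have h5 : |r S μ| ≤ |r S μ - r S 0| + |r S 0| := by
    simpa using abs_add_le (r S μ - r S 0) (r S 0)
  linarith

/-! ### The posterior-sampling exchange -/

variable (O : P.Oracle r)

lemma gap_eq (μ : Cube m) (S : Finset (Fin m)) : P.gap r μ S = r (O.toFun μ) μ - r S μ := by
  rw [Problem.gap]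
  congr 1
  exact le_antisymm (Finset.sup'_le _ _ (O.optimal μ))
    (Finset.le_sup' (fun S' => r S' μ) (O.feasible μ))

lemma measurable_oracle_reward (hr : ∀ S ∈ P.superArms, Measurable (r S))
    {α : Type*} [MeasurableSpace α] {f g : α → Cube m} (hf : Measurable f) (hg : Measurable g) :
    Measurable fun q => r (O.toFun (f q)) (g q) := by
  have h : (fun q => r (O.toFun (f q)) (g q)) =
      fun q => ∑ S ∈ P.superArms, if S = O.toFun (f q) then r S (g q) else 0 := by
    ext q
    rw [Finset.sum_ite_eq' P.superArms (O.toFun (f q)) fun S => r S (g q), if_pos (O.feasible _)]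
  rw [h]
  refine Finset.measurable_sum _ fun S hS => ?_
  refine Measurable.ite ?_ ((hr S hS).comp hg) measurable_const
  have := (O.measurable_toFun.comp hf) (MeasurableSet.singleton S)
  convert this using 1
  ext q
  simp [eq_comm]

/-- Under β ⊗ β the pair (μ, θ) is exchangeable, so r(O μ, μ) may be replaced by r(O θ, θ). The new
difference may change sign, hence the passage through real integrals and the need for the bound `C`.
-/
lemma lintegral_gap_le (hr : ∀ S ∈ P.superArms, Measurable (r S))
    {C : ℝ} (hC : ∀ S ∈ P.superArms, ∀ μ, |r S μ| ≤ C)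
    (β : Measure (Cube m)) [IsProbabilityMeasure β] :
    ∫⁻ μ, ∫⁻ θ, ENNReal.ofReal (P.gap r μ (O.toFun θ)) ∂β ∂β ≤
      ∫⁻ μ, ∫⁻ θ, ENNReal.ofReal |r (O.toFun θ) θ - r (O.toFun θ) μ| ∂β ∂β := by
  have hQ : ∀ {f g : Cube m × Cube m → Cube m}, Measurable f → Measurable g →
      Integrable (fun q => r (O.toFun (f q)) (g q)) (β.prod β) := fun hf hg =>
    Integrable.of_bound (measurable_oracle_reward P O hr hf hg).aestronglyMeasurable C
      (Filter.Eventually.of_forall fun q => hC _ (O.feasible _) _)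
  have hf : Measurable (Prod.fst : Cube m × Cube m → Cube m) := measurable_fst
  have hs : Measurable (Prod.snd : Cube m × Cube m → Cube m) := measurable_snd
  have h1 := hQ hf hf
  have h2 := hQ hs hf
  have h3 := hQ hs hs
  have h12 : Integrable (fun q : Cube m × Cube m => r (O.toFun q.1) q.1 - r (O.toFun q.2) q.1)
      (β.prod β) := h1.sub h2
  have h32 : Integrable (fun q : Cube m × Cube m => |r (O.toFun q.2) q.2 - r (O.toFun q.2) q.1|)
      (β.prod β) := (h3.sub h2).abs
  have hgap : ∀ μ θ, P.gap r μ (O.toFun θ) = r (O.toFun μ) μ - r (O.toFun θ) μ :=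
    fun μ θ => gap_eq P O μ _
  simp_rw [hgap]
  rw [← lintegral_prod (fun q : Cube m × Cube m =>
      ENNReal.ofReal (r (O.toFun q.1) q.1 - r (O.toFun q.2) q.1))
      h12.aemeasurable.ennreal_ofReal,
    ← lintegral_prod (fun q : Cube m × Cube m =>
      ENNReal.ofReal |r (O.toFun q.2) q.2 - r (O.toFun q.2) q.1|)
      h32.aemeasurable.ennreal_ofReal,
    ← ofReal_integral_eq_lintegral_ofReal h12
      (Filter.Eventually.of_forall fun q => sub_nonneg.2 (O.optimal _ _ (O.feasible _))),
    ← ofReal_integral_eq_lintegral_ofReal h32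
      (Filter.Eventually.of_forall fun q => abs_nonneg _)]
  refine ENNReal.ofReal_le_ofReal ?_
  have h4 : ∫ q : Cube m × Cube m, r (O.toFun q.1) q.1 ∂(β.prod β) =
      ∫ q : Cube m × Cube m, r (O.toFun q.2) q.2 ∂(β.prod β) :=
    (integral_prod_swap (fun q : Cube m × Cube m => r (O.toFun q.1) q.1)).symm
  calc ∫ q : Cube m × Cube m, (r (O.toFun q.1) q.1 - r (O.toFun q.2) q.1) ∂(β.prod β)
      = ∫ q : Cube m × Cube m, (r (O.toFun q.2) q.2 - r (O.toFun q.2) q.1) ∂(β.prod β) := by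
        rw [integral_sub h1 h2, integral_sub h3 h2, h4]
    _ ≤ _ := integral_mono (h3.sub h2) h32 fun q => le_abs_self _

end

/-! ### Confidence radii and their sums -/

/-- The number of past observations of base arm `i`. -/
def pulls (c : Fin m → ℕ × ℕ) (i : Fin m) : ℕ := (c i).1 + (c i).2

/-- The confidence radius after `n` observations. -/
def radius (L : ℝ) (n : ℕ) : ℝ := if n = 0 then 1 else √(L / n)

/-- The parameter vectors whose coordinate `i` is far from the empirical mean. -/
def farSet (L : ℝ) (c : Fin m → ℕ × ℕ) (i : Fin m) : Set (Cube m) :=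
  {x | radius L (pulls c i) < |(x i : ℝ) - empMean (c i)|}

lemma measurableSet_farSet (L : ℝ) (c : Fin m → ℕ × ℕ) (i : Fin m) :
    MeasurableSet (farSet L c i) :=
  measurableSet_lt measurable_const (by fun_prop)

lemma sampleKernel_farSet_le {L : ℝ} (hL : 0 ≤ L) (c : Fin m → ℕ × ℕ) (i : Fin m) :
    sampleKernel m c (farSet L c i) ≤ ENNReal.ofReal ((pulls c i + 1) * Real.exp (-L)) := by
  rcases Nat.eq_zero_or_pos (pulls c i) with h0 | hpos
  -- Without observations the radius is 1 and the empirical mean is 0/0 = 0, so no point of the cube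
  -- is far.
  · have : farSet L c i = ∅ := by
      refine Set.eq_empty_of_forall_notMem fun x hx => ?_
      change radius L (pulls c i) < |(x i : ℝ) - empMean (c i)| at hx
      have h1 : (c i).1 = 0 := by unfold pulls at h0; omega
      have h2 : (0 : ℝ) ≤ x i := (x i).2.1
      have h3 : (x i : ℝ) ≤ 1 := (x i).2.2
      rw [h0, radius, if_pos rfl, empMean, h1, Nat.cast_zero, zero_div, sub_zero,
        abs_of_nonneg h2] at hx
      linarith
    simp [this]
  · have hmeas : MeasurableSet {x : I | √(L / pulls c i) < |(x : ℝ) - empMean (c i)|} :=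
      measurableSet_lt measurable_const (by fun_prop)
    have h1 : farSet L c i =
        Function.eval i ⁻¹' {x : I | √(L / pulls c i) < |(x : ℝ) - empMean (c i)|} := by
      rw [farSet, radius, if_neg hpos.ne']
      rfl
    rw [h1, sampleKernel_apply, (measurePreserving_eval _ i).measure_preimage hmeas.nullMeasurableSet]
    refine (betaI_tail_le (c i) hpos (Real.sqrt_nonneg _)).trans_eq ?_
    have hpos' : (0 : ℝ) < ((c i).1 + (c i).2 : ℕ) := by exact_mod_cast hpos
    rw [Real.sq_sqrt (by positivity), pulls, mul_div_cancel₀ _ hpos'.ne']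

lemma abs_sub_le_radius (L : ℝ) (c : Fin m → ℕ × ℕ) (i : Fin m) (θ μ : Cube m) :
    ENNReal.ofReal |(μ i : ℝ) - (θ i : ℝ)| ≤ 2 * ENNReal.ofReal (radius L (pulls c i)) +
      (farSet L c i).indicator 1 θ + (farSet L c i).indicator 1 μ := by
  have hle : |(μ i : ℝ) - (θ i : ℝ)| ≤ 1 := by
    have h1 := (μ i).2.1
    have h2 := (μ i).2.2
    have h3 := (θ i).2.1
    have h4 := (θ i).2.2
    rw [abs_le]; constructor <;> linarith
  have hle' : ENNReal.ofReal |(μ i : ℝ) - (θ i : ℝ)| ≤ 1 := by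
    simpa using ENNReal.ofReal_le_ofReal hle
  by_cases hθ : θ ∈ farSet L c i
  · rw [Set.indicator_of_mem hθ]
    exact hle'.trans (le_add_right (le_add_left le_rfl))
  by_cases hμ : μ ∈ farSet L c i
  · rw [Set.indicator_of_mem hμ]
    exact hle'.trans (le_add_left le_rfl)
  refine le_add_right (le_add_right ?_)
  have h1 : |(θ i : ℝ) - empMean (c i)| ≤ radius L (pulls c i) := not_lt.1 hθ
  have h2 : |(μ i : ℝ) - empMean (c i)| ≤ radius L (pulls c i) := not_lt.1 hμ
  have h3 := abs_sub_le (μ i : ℝ) (empMean (c i)) (θ i)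
  rw [abs_sub_comm (empMean (c i))] at h3
  rw [← ENNReal.ofReal_ofNat 2, ← ENNReal.ofReal_mul (by norm_num)]
  exact ENNReal.ofReal_le_ofReal (by linarith)

/-- While positive, the term with k + 1 = j is at most 2√j − 2√(j − 1) − κ. These telescope to 2√n −
nκ ≤ 1/κ, and all later terms vanish. -/
lemma sum_max_sub_le {κ : ℝ} (hκ : 0 < κ) (n : ℕ) :
    ∑ k ∈ Finset.range n, max 0 (1 / √(k + 1 : ℝ) - κ) ≤ 1 / κ := by
  have amgm : ∀ n : ℕ, 2 * √(n : ℝ) - n * κ ≤ 1 / κ := by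
    intro n
    rw [le_div_iff₀ hκ]
    have h : (√(n : ℝ) * κ) ^ 2 = n * κ * κ := by
      rw [mul_pow, Real.sq_sqrt (Nat.cast_nonneg n)]; ring
    nlinarith [sq_nonneg (√(n : ℝ) * κ - 1)]
  -- The second clause carries the telescoped bound as long as the terms are positive; afterwards
  -- only the first is propagated.
  suffices h : ∑ k ∈ Finset.range n, max 0 (1 / √(k + 1 : ℝ) - κ) ≤ 1 / κ ∧
      (κ * √(n : ℝ) < 1 → ∑ k ∈ Finset.range n, max 0 (1 / √(k + 1 : ℝ) - κ) ≤
        2 * √(n : ℝ) - n * κ) from h.1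
  induction n with
  | zero => simp [hκ.le]
  | succ n ih =>
    rw [Finset.sum_range_succ]
    push_cast
    have hpos : 0 < √(n + 1 : ℝ) := Real.sqrt_pos.2 (by positivity)
    have hmono : √(n : ℝ) ≤ √(n + 1 : ℝ) := Real.sqrt_le_sqrt (by linarith)
    by_cases h : κ * √(n + 1 : ℝ) < 1
    · have h1 := ih.2 (lt_of_le_of_lt (by gcongr) h)
      have h2 : κ ≤ 1 / √(n + 1 : ℝ) := by
        rw [le_div_iff₀ hpos]; exact h.le
      rw [max_eq_right (by linarith)]
      have h3 : 1 / √(n + 1 : ℝ) ≤ 2 * √(n + 1 : ℝ) - 2 * √(n : ℝ) := by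
        rw [div_le_iff₀ hpos]
        have e1 := Real.sq_sqrt (Nat.cast_nonneg (α := ℝ) n)
        have e2 := Real.sq_sqrt (show (0 : ℝ) ≤ n + 1 by positivity)
        nlinarith [sq_nonneg (√(n + 1 : ℝ) - √(n : ℝ))]
      have h4 := amgm (n + 1)
      push_cast at h4
      constructor
      · linarith
      · intro _; linarith
    · have h2 : 1 / √(n + 1 : ℝ) ≤ κ := by
        rw [div_le_iff₀ hpos]; exact not_lt.1 h
      rw [max_eq_left (by linarith), add_zero]
      exact ⟨ih.1, fun h' => absurd h' h⟩

/-- The excess of the confidence radius over `√L * κ`. -/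
def excess (L κ : ℝ) (n : ℕ) : ℝ := if n = 0 then 1 else √L * max 0 (1 / √(n : ℝ) - κ)

lemma excess_nonneg (L κ : ℝ) (n : ℕ) : 0 ≤ excess L κ n := by
  unfold excess; split_ifs
  · exact zero_le_one
  · exact mul_nonneg (Real.sqrt_nonneg _) (le_max_left _ _)

lemma radius_le_add_excess {L κ : ℝ} (hL : 0 ≤ L) (hκ : 0 < κ) (n : ℕ) :
    radius L n ≤ √L * κ + excess L κ n := by
  unfold radius excess
  split_ifs
  · have : 0 ≤ √L * κ := by positivity
    linarith
  · rw [Real.sqrt_div hL, ← mul_add, div_eq_mul_one_div]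
    refine mul_le_mul_of_nonneg_left ?_ (Real.sqrt_nonneg _)
    linarith [le_max_right 0 (1 / √(n : ℝ) - κ)]

lemma sum_excess_le {L κ : ℝ} (hκ : 0 < κ) (n : ℕ) :
    ∑ k ∈ Finset.range n, excess L κ k ≤ 1 + √L / κ := by
  -- One extra term makes the range nonempty, so that the index 0 term, equal to 1, can be split
  -- off.
  have h1 : ∑ k ∈ Finset.range n, excess L κ k ≤ ∑ k ∈ Finset.range (n + 1), excess L κ k :=
    Finset.sum_le_sum_of_subset_of_nonneg (Finset.range_mono (Nat.le_succ n))
      fun _ _ _ => excess_nonneg _ _ _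
  refine h1.trans ?_
  rw [Finset.sum_range_succ', add_comm]
  have h2 : ∀ k : ℕ, excess L κ (k + 1) = √L * max 0 (1 / √(k + 1 : ℝ) - κ) := by
    intro k; simp [excess]
  simp_rw [h2]
  rw [← Finset.mul_sum, div_eq_mul_one_div √L κ]
  have h3 : excess L κ 0 = 1 := by simp [excess]
  rw [h3]
  gcongr
  exact sum_max_sub_le hκ n

/-! ### Counting triggered rounds -/

section

variable (P : Problem m) {r : Finset (Fin m) → Cube m → ℝ} (O : P.Oracle r) (D : Env m)

/-- The sum over k < N_i grows in a round by φ(N_i) exactly when i is triggered, which has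
probability p_i given the counts and θ. Summing over rounds telescopes. -/
lemma sum_lintegral_trigProb (i : Fin m) (φ : ℕ → ℝ≥0∞) (T : ℕ) :
    ∑ t ∈ Finset.range T, ∫⁻ c, ∫⁻ θ, P.trigProb D (O.toFun θ) i * φ (pulls c i)
        ∂(sampleKernel m c) ∂(countsLaw P O D t) =
      ∫⁻ c, ∑ k ∈ Finset.range (pulls c i), φ k ∂(countsLaw P O D T) := by
  induction T with
  | zero => simp [countsLaw_zero, lintegral_dirac, pulls]
  | succ T ih =>
    rw [Finset.sum_range_succ, ih, lintegral_countsLaw_succ,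
      ← lintegral_add_left (.of_discrete)]
    refine lintegral_congr fun c => ?_
    have h1 : ∀ o : Feedback m, ∑ k ∈ Finset.range (pulls (c + increment o) i), φ k =
        ∑ k ∈ Finset.range (pulls c i), φ k + {o : Feedback m | i ∈ o.1}.indicator
          (fun _ => φ (pulls c i)) o := by
      intro o
      have h2 : pulls (c + increment o) i = pulls c i + if i ∈ o.1 then 1 else 0 := by
        rw [← increment_le_one o i]
        simp only [pulls, Pi.add_apply, Prod.fst_add, Prod.snd_add]
        ring
      by_cases hi : i ∈ o.1
      · simp [h2, hi, Finset.sum_range_succ]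
      · simp [h2, hi]
    simp_rw [h1]
    have h3 : ∀ θ, ∫⁻ o, (∑ k ∈ Finset.range (pulls c i), φ k +
        {o : Feedback m | i ∈ o.1}.indicator (fun _ => φ (pulls c i)) o)
          ∂(feedbackLaw P D (O.toFun θ)) =
        ∑ k ∈ Finset.range (pulls c i), φ k + P.trigProb D (O.toFun θ) i * φ (pulls c i) := by
      intro θ
      rw [lintegral_add_left measurable_const, lintegral_const, measure_univ, mul_one,
        lintegral_indicator_const (.of_discrete), trigProb_eq_feedbackLaw, mul_comm]
    simp_rw [h3]
    rw [lintegral_add_left measurable_const, lintegral_const, measure_univ, mul_one]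

lemma trigProb_le_one (S : Finset (Fin m)) (i : Fin m) : P.trigProb D S i ≤ 1 := prob_le_one

lemma minProb_le_trigProb {S : Finset (Fin m)} (hS : S ∈ P.superArms) {i : Fin m}
    (hi : i ∈ P.triggeringSet D S) : P.minProb D ≤ P.trigProb D S i :=
  (iInf_le _ i).trans (iInf₂_le_of_le S hS (iInf_le _ hi))

open Classical in
/-- The indicator of the event that the super arm selected by the oracle can trigger `i`. -/
def canTrigger (i : Fin m) (θ : Cube m) : ℝ≥0∞ :=
  if i ∈ P.triggeringSet D (O.toFun θ) then 1 else 0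

lemma measurable_canTrigger (i : Fin m) : Measurable (canTrigger P O D i) :=
  by
  classical
  exact measurable_oracle_comp P O fun S => if i ∈ P.triggeringSet D S then (1 : ℝ≥0∞) else 0

lemma canTrigger_le_one (i : Fin m) (θ : Cube m) : canTrigger P O D i θ ≤ 1 := by
  unfold canTrigger; split_ifs <;> simp

/-- The indicator that S can trigger i is at most p_i / p*, which reduces the sum to the telescoped
one. -/
lemma sum_lintegral_canTrigger_le (i : Fin m) {φ : ℕ → ℝ≥0∞} {M : ℝ≥0∞}
    (hM : ∀ n, ∑ k ∈ Finset.range n, φ k ≤ M) (hp0 : P.minProb D ≠ 0) (hp1 : P.minProb D ≠ ⊤)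
    (T : ℕ) :
    ∑ t ∈ Finset.range T, ∫⁻ c, ∫⁻ θ, canTrigger P O D i θ * φ (pulls c i)
        ∂(sampleKernel m c) ∂(countsLaw P O D t) ≤ (P.minProb D)⁻¹ * M := by
  have h1 : P.minProb D * ∑ t ∈ Finset.range T, ∫⁻ c, ∫⁻ θ, canTrigger P O D i θ * φ (pulls c i)
        ∂(sampleKernel m c) ∂(countsLaw P O D t) ≤ M := by
    calc _ = ∑ t ∈ Finset.range T, ∫⁻ c, ∫⁻ θ, P.minProb D * (canTrigger P O D i θ *
          φ (pulls c i)) ∂(sampleKernel m c) ∂(countsLaw P O D t) := by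
          rw [Finset.mul_sum]
          simp_rw [lintegral_const_mul' _ _ hp1]
      _ ≤ ∑ t ∈ Finset.range T, ∫⁻ c, ∫⁻ θ, P.trigProb D (O.toFun θ) i * φ (pulls c i)
          ∂(sampleKernel m c) ∂(countsLaw P O D t) := by
          refine Finset.sum_le_sum fun t _ => lintegral_mono fun c => lintegral_mono fun θ => ?_
          rw [← mul_assoc]
          refine mul_le_mul_left ?_ _
          unfold canTrigger
          split_ifs with hi
          · rw [mul_one]
            exact minProb_le_trigProb P D (O.feasible θ) hi
          · simp
      _ = ∫⁻ c, ∑ k ∈ Finset.range (pulls c i), φ k ∂(countsLaw P O D T) :=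
          sum_lintegral_trigProb P O D i φ T
      _ ≤ ∫⁻ _, M ∂(countsLaw P O D T) := by gcongr; exact hM _
      _ = M := by simp
  calc _ = (P.minProb D)⁻¹ * (P.minProb D * ∑ t ∈ Finset.range T, ∫⁻ c, ∫⁻ θ,
        canTrigger P O D i θ * φ (pulls c i) ∂(sampleKernel m c) ∂(countsLaw P O D t)) := by
        rw [← mul_assoc, ENNReal.inv_mul_cancel hp0 hp1, one_mul]
    _ ≤ _ := by gcongr

lemma sum_lintegral_radius_le (i : Fin m) {L : ℝ} (hL : 0 < L) {T : ℕ} (hT : 0 < T) :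
    ∑ t ∈ Finset.range T, ∫⁻ c, ∫⁻ θ, canTrigger P O D i θ * ENNReal.ofReal (radius L (pulls c i))
        ∂(sampleKernel m c) ∂(countsLaw P O D t) ≤
      ENNReal.ofReal (2 * √(T * L)) * ((P.minProb D)⁻¹) ^ (1 / 2 : ℝ) + (P.minProb D)⁻¹ := by
  by_cases hp0 : P.minProb D = 0
  -- The right-hand side is infinite.
  · simp [hp0]
  by_cases hp1 : P.minProb D = ⊤
  · have : ∀ θ, canTrigger P O D i θ = 0 := by
      intro θ
      unfold canTrigger
      rw [if_neg]
      intro hi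
      have := (minProb_le_trigProb P D (O.feasible θ) hi).trans (trigProb_le_one P D _ i)
      rw [hp1] at this
      exact absurd this (by simp)
    simp [this]
  obtain ⟨p, hp⟩ : ∃ p : ℝ, P.minProb D = ENNReal.ofReal p :=
    ⟨(P.minProb D).toReal, (ENNReal.ofReal_toReal hp1).symm⟩
  have hppos : 0 < p := by
    rw [hp] at hp0
    simpa using hp0
  have hT' : (0 : ℝ) < T := by exact_mod_cast hT
  -- This value balances T√L κ, paid over all rounds, against √L/(p κ), the excess after division by
  -- p.
  set κ : ℝ := 1 / √(p * T) with hκ_def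
  have hκ : 0 < κ := by positivity
  have hM : ∀ n, ∑ k ∈ Finset.range n, ENNReal.ofReal (excess L κ k) ≤
      ENNReal.ofReal (1 + √L / κ) := by
    intro n
    rw [← ENNReal.ofReal_sum_of_nonneg fun k _ => excess_nonneg L κ k]
    exact ENNReal.ofReal_le_ofReal (sum_excess_le hκ n)
  have hpt : ∀ (c : Fin m → ℕ × ℕ) (θ : Cube m),
      canTrigger P O D i θ * ENNReal.ofReal (radius L (pulls c i)) ≤ ENNReal.ofReal (√L * κ) +
        canTrigger P O D i θ * ENNReal.ofReal (excess L κ (pulls c i)) := by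
    intro c θ
    calc _ ≤ canTrigger P O D i θ * (ENNReal.ofReal (√L * κ) +
          ENNReal.ofReal (excess L κ (pulls c i))) := by
          rw [← ENNReal.ofReal_add (by positivity) (excess_nonneg _ _ _)]
          gcongr
          exact radius_le_add_excess hL.le hκ _
      _ ≤ _ := by
          rw [mul_add]
          gcongr
          exact mul_le_of_le_one_left' (canTrigger_le_one P O D i θ)
  calc _ ≤ ∑ t ∈ Finset.range T, ∫⁻ c, ∫⁻ θ, (ENNReal.ofReal (√L * κ) +
        canTrigger P O D i θ * ENNReal.ofReal (excess L κ (pulls c i)))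
          ∂(sampleKernel m c) ∂(countsLaw P O D t) := by
        gcongr with t ht c θ
        exact hpt c θ
    _ = T * ENNReal.ofReal (√L * κ) + ∑ t ∈ Finset.range T, ∫⁻ c, ∫⁻ θ,
        canTrigger P O D i θ * ENNReal.ofReal (excess L κ (pulls c i))
          ∂(sampleKernel m c) ∂(countsLaw P O D t) := by
        have : ∀ t, ∫⁻ c, ∫⁻ θ, (ENNReal.ofReal (√L * κ) +
            canTrigger P O D i θ * ENNReal.ofReal (excess L κ (pulls c i)))
              ∂(sampleKernel m c) ∂(countsLaw P O D t) = ENNReal.ofReal (√L * κ) +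
            ∫⁻ c, ∫⁻ θ, canTrigger P O D i θ * ENNReal.ofReal (excess L κ (pulls c i))
              ∂(sampleKernel m c) ∂(countsLaw P O D t) := by
          intro t
          simp_rw [lintegral_add_left measurable_const, lintegral_const, measure_univ, mul_one]
          rw [lintegral_add_left measurable_const, lintegral_const, measure_univ, mul_one]
        simp_rw [this]
        rw [Finset.sum_add_distrib]
        simp
    _ ≤ T * ENNReal.ofReal (√L * κ) + (P.minProb D)⁻¹ * ENNReal.ofReal (1 + √L / κ) := by
        gcongr
        exact sum_lintegral_canTrigger_le P O D i hM hp0 hp1 T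
    _ = _ := by
        rw [hp, ← ENNReal.ofReal_inv_of_pos hppos, ENNReal.ofReal_rpow_of_pos (by positivity),
          ← ENNReal.ofReal_natCast, ← ENNReal.ofReal_mul (by positivity),
          ← ENNReal.ofReal_mul (by positivity), ← ENNReal.ofReal_mul (by positivity),
          ← ENNReal.ofReal_add (by positivity) (by positivity),
          ← ENNReal.ofReal_add (by positivity) (by positivity), ← Real.sqrt_eq_rpow,
          Real.sqrt_inv, hκ_def, Real.sqrt_mul hT'.le, Real.sqrt_mul hppos.le]
        congr 1
        have e1 : 0 < √p := Real.sqrt_pos.2 hppos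
        have e2 : 0 < √(T : ℝ) := Real.sqrt_pos.2 hT'
        have e3 : p = √p ^ 2 := (Real.sq_sqrt hppos.le).symm
        have e4 : (T : ℝ) = √(T : ℝ) ^ 2 := (Real.sq_sqrt hT'.le).symm
        generalize √p = a at *
        generalize √(T : ℝ) = b at *
        rw [e3, e4]
        field_simp
        ring

end

/-! ### Averaging over the prior -/

section

variable (P : Problem m) {r : Finset (Fin m) → Cube m → ℝ} (O : P.Oracle r)

lemma lintegral_countsLaw_eq_tsum (h_trig : P.TriggersThroughBinaryArms) {D : Env m}
    (hD : D ∈ P.envs) (n : ℕ) (F : (Fin m → ℕ × ℕ) → ℝ≥0∞) :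
    ∫⁻ c, F c ∂(countsLaw P O D n) =
      ∑' c, countsWeight P O n c * (lik c (meanVec D) * F c) := by
  rw [lintegral_countable']
  refine tsum_congr fun c => ?_
  rw [countsLaw_singleton P O h_trig hD]
  ring

lemma ae_pulls_le (h_trig : P.TriggersThroughBinaryArms) {D : Env m}
    (hD : D ∈ P.envs) (n : ℕ) (i : Fin m) : ∀ᵐ c ∂(countsLaw P O D n), pulls c i ≤ n := by
  refine ae_iff_of_countable.2 fun c hc => ?_
  rw [countsLaw_singleton P O h_trig hD] at hc
  exact le_of_countsWeight_ne_zero P O (left_ne_zero_of_mul hc) i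

variable {prior : Measure (Env m)}

/-- For almost every D the integral is a countable series of measurable functions of μ, which avoids
any measurability of `historyLaw` in D. -/
lemma aemeasurable_lintegral_countsLaw (h_trig : P.TriggersThroughBinaryArms)
    (h_class : ∀ᵐ D ∂prior, D ∈ P.envs) (h_uniform : prior.map meanVec = volume) (n : ℕ)
    {G : (Fin m → ℕ × ℕ) → Cube m → ℝ≥0∞} (hG : ∀ c, Measurable (G c)) :
    AEMeasurable (fun D => ∫⁻ c, G c (meanVec D) ∂(countsLaw P O D n)) prior := by
  have h1 : Measurable fun x => ∑' c, countsWeight P O n c * (lik c x * G c x) :=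
    Measurable.tsum fun c => ((measurable_lik c).mul (hG c)).const_mul _
  refine (h1.comp_aemeasurable (aemeasurable_meanVec h_uniform)).congr ?_
  filter_upwards [h_class] with D hD
  exact (lintegral_countsLaw_eq_tsum P O h_trig hD n fun c => G c (meanVec D)).symm

/-- Given the counts, the mean outcome vector has the law of the sampled parameter vector. -/
lemma lintegral_lintegral_countsLaw (h_trig : P.TriggersThroughBinaryArms)
    (h_class : ∀ᵐ D ∂prior, D ∈ P.envs) (h_uniform : prior.map meanVec = volume) (n : ℕ)
    {G : (Fin m → ℕ × ℕ) → Cube m → ℝ≥0∞} (hG : ∀ c, Measurable (G c)) :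
    ∫⁻ D, ∫⁻ c, G c (meanVec D) ∂(countsLaw P O D n) ∂prior =
      ∑' c, countsWeight P O n c * (evidence c * ∫⁻ x, G c x ∂(sampleKernel m c)) := by
  have h1 : ∀ c, Measurable fun x => countsWeight P O n c * (lik c x * G c x) :=
    fun c => ((measurable_lik c).mul (hG c)).const_mul _
  calc _ = ∫⁻ D, ∑' c, countsWeight P O n c * (lik c (meanVec D) * G c (meanVec D)) ∂prior := by
        refine lintegral_congr_ae ?_
        filter_upwards [h_class] with D hD
        exact lintegral_countsLaw_eq_tsum P O h_trig hD n fun c => G c (meanVec D)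
    _ = ∫⁻ x, ∑' c, countsWeight P O n c * (lik c x * G c x) := by
        rw [← h_uniform]
        exact (lintegral_map' (Measurable.tsum h1).aemeasurable
          (aemeasurable_meanVec h_uniform)).symm
    _ = _ := by
        rw [lintegral_tsum fun c => (h1 c).aemeasurable]
        refine tsum_congr fun c => ?_
        rw [← lintegral_lik_mul c (hG c)]
        exact lintegral_const_mul _ ((measurable_lik c).mul (hG c))

/-- The summands are the prior predictive probabilities of the counts. -/
lemma tsum_countsWeight_mul_evidence [IsProbabilityMeasure prior]
    (h_trig : P.TriggersThroughBinaryArms) (h_class : ∀ᵐ D ∂prior, D ∈ P.envs)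
    (h_uniform : prior.map meanVec = volume) (n : ℕ) :
    ∑' c, countsWeight P O n c * evidence c = 1 := by
  have h := lintegral_lintegral_countsLaw P O h_trig h_class h_uniform n
    (G := fun _ _ => 1) fun _ => measurable_const
  simpa using h.symm

/-- No concentration at a fixed μ is involved: given the counts, μ has the Beta law, so the tail
bound for θ applies to it. -/
lemma lintegral_lintegral_farSet_le [IsProbabilityMeasure prior]
    (h_trig : P.TriggersThroughBinaryArms) (h_class : ∀ᵐ D ∂prior, D ∈ P.envs)
    (h_uniform : prior.map meanVec = volume) (n : ℕ) {L : ℝ} (hL : 0 ≤ L) (i : Fin m) :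
    ∫⁻ D, ∫⁻ c, (farSet L c i).indicator 1 (meanVec D) ∂(countsLaw P O D n) ∂prior ≤
      ENNReal.ofReal ((n + 1) * Real.exp (-L)) := by
  rw [lintegral_lintegral_countsLaw P O h_trig h_class h_uniform n
    (G := fun c => (farSet L c i).indicator 1)
    fun c => measurable_one.indicator (measurableSet_farSet L c i)]
  simp_rw [lintegral_indicator_one (measurableSet_farSet L _ i)]
  calc _ ≤ ∑' c, countsWeight P O n c * evidence c *
        ENNReal.ofReal ((n + 1) * Real.exp (-L)) := by
        refine ENNReal.tsum_le_tsum fun c => ?_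
        rw [← mul_assoc]
        by_cases hc : countsWeight P O n c = 0
        · simp [hc]
        gcongr
        refine (sampleKernel_farSet_le hL c i).trans (ENNReal.ofReal_le_ofReal ?_)
        gcongr
        exact le_of_countsWeight_ne_zero P O hc i
    _ = _ := by
        rw [ENNReal.tsum_mul_right,
          tsum_countsWeight_mul_evidence P O h_trig h_class h_uniform, one_mul]

lemma lintegral_countsLaw_farSet_le (h_trig : P.TriggersThroughBinaryArms) {D : Env m}
    (hD : D ∈ P.envs) (n : ℕ) {L : ℝ} (hL : 0 ≤ L) (i : Fin m) :
    ∫⁻ c, sampleKernel m c (farSet L c i) ∂(countsLaw P O D n) ≤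
      ENNReal.ofReal ((n + 1) * Real.exp (-L)) := by
  calc _ ≤ ∫⁻ _, ENNReal.ofReal ((n + 1) * Real.exp (-L)) ∂(countsLaw P O D n) := by
        refine lintegral_mono_ae ?_
        filter_upwards [ae_pulls_le P O h_trig hD n i] with c hc
        refine (sampleKernel_farSet_le hL c i).trans (ENNReal.ofReal_le_ofReal ?_)
        gcongr
    _ = _ := by simp

lemma trigProb_eq_sum (h_trig : P.TriggersThroughBinaryArms) {D : Env m} (hD : D ∈ P.envs)
    {S : Finset (Fin m)} (hS : S ∈ P.superArms) (i : Fin m) :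
    P.trigProb D S i = ∑ o : Feedback m, ({o : Feedback m | i ∈ o.1}).indicator
      (fun o => feedbackWeight P S o * lik (increment o) (meanVec D)) o := by
  rw [trigProb_eq_feedbackLaw, ← lintegral_indicator_one (.of_discrete), lintegral_fintype]
  refine Finset.sum_congr rfl fun o _ => ?_
  rw [feedbackLaw_singleton P h_trig hD hS]
  by_cases hi : i ∈ o.1 <;> simp [hi]

/-- For environments in the class the triggering probabilities are polynomials in μ, so p* is a
measurable function of μ. -/
lemma aemeasurable_minProb (h_trig : P.TriggersThroughBinaryArms)
    (h_class : ∀ᵐ D ∂prior, D ∈ P.envs) (h_uniform : prior.map meanVec = volume) :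
    AEMeasurable P.minProb prior := by
  classical
  let q : Finset (Fin m) → Fin m → Cube m → ℝ≥0∞ := fun S i x =>
    ∑ o : Feedback m, ({o : Feedback m | i ∈ o.1}).indicator
      (fun o => feedbackWeight P S o * lik (increment o) x) o
  have hq : ∀ S i, Measurable (q S i) := by
    intro S i
    refine Finset.measurable_sum _ fun o _ => ?_
    by_cases hi : i ∈ o.1
    · simpa [hi] using (measurable_lik (increment o)).const_mul (feedbackWeight P S o)
    · simp [hi]
  have hmeas : Measurable fun x => ⨅ i, ⨅ S ∈ P.superArms, if 0 < q S i x then q S i x else ⊤ :=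
    Measurable.iInf fun i => Measurable.iInf fun S => Measurable.iInf fun _ =>
      Measurable.ite (measurableSet_lt measurable_const (hq S i)) (hq S i) measurable_const
  refine (hmeas.comp_aemeasurable (aemeasurable_meanVec h_uniform)).congr ?_
  filter_upwards [h_class] with D hD
  rw [Function.comp_apply, Problem.minProb]
  refine iInf_congr fun i => iInf_congr fun S => iInf_congr fun hS => ?_
  rw [iInf_eq_if]
  simp only [Problem.triggeringSet, Finset.mem_filter, Finset.mem_univ, true_and,
    trigProb_eq_sum P h_trig hD hS, q]

/-- The exchange of μ and θ is made separately for each value of the counts, where both have law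
`sampleKernel m c`. -/
lemma bayesRegret_le_lintegral {B : ℝ} (hB : 0 < B) (h_lipschitz : P.LipschitzReward r B)
    (h_trig : P.TriggersThroughBinaryArms) (h_class : ∀ᵐ D ∂prior, D ∈ P.envs)
    (h_uniform : prior.map meanVec = volume) (T : ℕ) :
    bayesRegret P O prior T ≤ ∫⁻ D, ∑ t ∈ Finset.range T, ∫⁻ c, ∫⁻ θ,
      ENNReal.ofReal |r (O.toFun θ) θ - r (O.toFun θ) (meanVec D)| ∂(sampleKernel m c)
        ∂(countsLaw P O D t) ∂prior := by
  have hlip : ∀ S ∈ P.superArms, ∀ μ μ' : Cube m,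
      |r S μ - r S μ'| ≤ B * ∑ i, |(μ i : ℝ) - (μ' i : ℝ)| := fun S hS =>
    abs_reward_sub_le P hB h_lipschitz h_class h_uniform hS
  have hr : ∀ S ∈ P.superArms, Measurable (r S) := fun S hS => measurable_reward P hlip hB hS
  obtain ⟨C, hC⟩ := exists_abs_reward_le P hlip hB
  have hμ : Measurable fun q : Cube m × Cube m => r (O.toFun q.2) q.1 :=
    measurable_oracle_reward P O hr measurable_snd measurable_fst
  have h1 : Measurable fun q : Cube m × Cube m =>
      ENNReal.ofReal (P.gap r q.1 (O.toFun q.2)) := by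
    simp_rw [gap_eq P O]
    exact ((measurable_oracle_reward P O hr measurable_fst measurable_fst).sub hμ).ennreal_ofReal
  have h2 : Measurable fun q : Cube m × Cube m =>
      ENNReal.ofReal |r (O.toFun q.2) q.2 - r (O.toFun q.2) q.1| :=
    (((measurable_oracle_reward P O hr measurable_snd measurable_snd).sub hμ).abs).ennreal_ofReal
  have hG1 : ∀ c, Measurable fun μ => ∫⁻ θ, ENNReal.ofReal (P.gap r μ (O.toFun θ))
      ∂(sampleKernel m c) := fun c => h1.lintegral_prod_right'
  have hG2 : ∀ c, Measurable fun μ => ∫⁻ θ,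
      ENNReal.ofReal |r (O.toFun θ) θ - r (O.toFun θ) μ| ∂(sampleKernel m c) :=
    fun c => h2.lintegral_prod_right'
  rw [bayesRegret]
  simp_rw [regret_eq_sum]
  rw [lintegral_finsetSum' _ fun t _ =>
      aemeasurable_lintegral_countsLaw P O h_trig h_class h_uniform t hG1,
    lintegral_finsetSum' _ fun t _ =>
      aemeasurable_lintegral_countsLaw P O h_trig h_class h_uniform t hG2]
  refine Finset.sum_le_sum fun t _ => ?_
  rw [lintegral_lintegral_countsLaw P O h_trig h_class h_uniform t hG1,
    lintegral_lintegral_countsLaw P O h_trig h_class h_uniform t hG2]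
  refine ENNReal.tsum_le_tsum fun c => ?_
  exact mul_le_mul' le_rfl (mul_le_mul' le_rfl (lintegral_gap_le P O hr hC (sampleKernel m c)))

lemma ofReal_abs_reward_sub_le {B : ℝ} (hB : 0 < B) (h_lipschitz : P.LipschitzReward r B)
    {D : Env m} (hD : D ∈ P.envs) (θ : Cube m) :
    ENNReal.ofReal |r (O.toFun θ) θ - r (O.toFun θ) (meanVec D)| ≤
      ENNReal.ofReal B * ∑ i, canTrigger P O D i θ *
        ENNReal.ofReal |(meanVec D i : ℝ) - (θ i : ℝ)| := by
  classical
  rw [abs_sub_comm]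
  refine (ENNReal.ofReal_le_ofReal (h_lipschitz _ (O.feasible θ) D hD θ)).trans_eq ?_
  rw [ENNReal.ofReal_mul hB.le, ENNReal.ofReal_sum_of_nonneg fun _ _ => abs_nonneg _]
  congr 1
  simp only [canTrigger, ite_mul, one_mul, zero_mul, Finset.sum_ite_mem, Finset.univ_inter]

lemma lintegral_abs_reward_sub_le {B : ℝ} (hB : 0 < B) (h_lipschitz : P.LipschitzReward r B)
    {D : Env m} (hD : D ∈ P.envs) (L : ℝ) (c : Fin m → ℕ × ℕ) :
    ∫⁻ θ, ENNReal.ofReal |r (O.toFun θ) θ - r (O.toFun θ) (meanVec D)| ∂(sampleKernel m c) ≤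
      ENNReal.ofReal B * ∑ i, (2 * ∫⁻ θ, canTrigger P O D i θ *
        ENNReal.ofReal (radius L (pulls c i)) ∂(sampleKernel m c) +
          sampleKernel m c (farSet L c i) + (farSet L c i).indicator 1 (meanVec D)) := by
  have hm1 : ∀ i, Measurable fun θ => 2 * (canTrigger P O D i θ *
      ENNReal.ofReal (radius L (pulls c i))) := fun i =>
    ((measurable_canTrigger P O D i).mul_const _).const_mul _
  have hm2 : ∀ i, Measurable ((farSet L c i).indicator (1 : Cube m → ℝ≥0∞)) := fun i =>
    measurable_one.indicator (measurableSet_farSet L c i)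
  have hm : ∀ i, Measurable fun θ => 2 * (canTrigger P O D i θ *
      ENNReal.ofReal (radius L (pulls c i))) + (farSet L c i).indicator 1 θ +
        (farSet L c i).indicator 1 (meanVec D) := fun i => ((hm1 i).add (hm2 i)).add_const _
  calc _ ≤ ∫⁻ θ, ENNReal.ofReal B * ∑ i, (2 * (canTrigger P O D i θ *
        ENNReal.ofReal (radius L (pulls c i))) + (farSet L c i).indicator 1 θ +
          (farSet L c i).indicator 1 (meanVec D)) ∂(sampleKernel m c) := by
        refine lintegral_mono fun θ => (ofReal_abs_reward_sub_le P O hB h_lipschitz hD θ).trans ?_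
        gcongr with i
        calc _ ≤ canTrigger P O D i θ * (2 * ENNReal.ofReal (radius L (pulls c i)) +
              (farSet L c i).indicator 1 θ + (farSet L c i).indicator 1 (meanVec D)) := by
              gcongr
              exact abs_sub_le_radius L c i θ (meanVec D)
          _ ≤ _ := by
              rw [mul_add, mul_add, mul_left_comm]
              gcongr
              · exact mul_le_of_le_one_left' (canTrigger_le_one P O D i θ)
              · exact mul_le_of_le_one_left' (canTrigger_le_one P O D i θ)
    _ = _ := by
        rw [lintegral_const_mul' _ _ ENNReal.ofReal_ne_top, lintegral_finsetSum _ fun i _ => hm i]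
        congr 1
        refine Finset.sum_congr rfl fun i _ => ?_
        rw [lintegral_add_right _ measurable_const, lintegral_add_right _ (hm2 i),
          lintegral_const_mul' _ _ (by simp), lintegral_indicator_one (measurableSet_farSet L c i),
          lintegral_const, measure_univ, mul_one]

/-- The bound holds for each fixed D, so the far events of μ stay unevaluated; their probability is
controlled only on average over the prior. -/
lemma sum_lintegral_abs_reward_sub_le {B : ℝ} (hB : 0 < B) (h_lipschitz : P.LipschitzReward r B)
    (h_trig : P.TriggersThroughBinaryArms) {D : Env m} (hD : D ∈ P.envs) {L : ℝ} (hL : 0 < L)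
    {T : ℕ} (hT : 0 < T) :
    ∑ t ∈ Finset.range T, ∫⁻ c, ∫⁻ θ,
      ENNReal.ofReal |r (O.toFun θ) θ - r (O.toFun θ) (meanVec D)| ∂(sampleKernel m c)
        ∂(countsLaw P O D t) ≤
      ENNReal.ofReal B * ∑ i, ((2 * (ENNReal.ofReal (2 * √(T * L)) *
        ((P.minProb D)⁻¹) ^ (1 / 2 : ℝ) + (P.minProb D)⁻¹) +
          ∑ t ∈ Finset.range T, ENNReal.ofReal ((t + 1) * Real.exp (-L))) +
          ∑ t ∈ Finset.range T, ∫⁻ c, (farSet L c i).indicator 1 (meanVec D)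
            ∂(countsLaw P O D t)) := by
  calc _ ≤ ∑ t ∈ Finset.range T, ∫⁻ c, ENNReal.ofReal B * ∑ i, (2 * ∫⁻ θ, canTrigger P O D i θ *
        ENNReal.ofReal (radius L (pulls c i)) ∂(sampleKernel m c) +
          sampleKernel m c (farSet L c i) + (farSet L c i).indicator 1 (meanVec D))
            ∂(countsLaw P O D t) :=
        Finset.sum_le_sum fun t _ => lintegral_mono fun c =>
          lintegral_abs_reward_sub_le P O hB h_lipschitz hD L c
    _ = ENNReal.ofReal B * ∑ i, ((2 * ∑ t ∈ Finset.range T, ∫⁻ c, ∫⁻ θ, canTrigger P O D i θ *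
        ENNReal.ofReal (radius L (pulls c i)) ∂(sampleKernel m c) ∂(countsLaw P O D t) +
          ∑ t ∈ Finset.range T, ∫⁻ c, sampleKernel m c (farSet L c i) ∂(countsLaw P O D t)) +
          ∑ t ∈ Finset.range T, ∫⁻ c, (farSet L c i).indicator 1 (meanVec D)
            ∂(countsLaw P O D t)) := by
        simp_rw [lintegral_const_mul' _ _ (ENNReal.ofReal_ne_top (r := B))]
        rw [← Finset.mul_sum]
        congr 1
        simp_rw [lintegral_finsetSum _ fun _ _ => Measurable.of_discrete]
        rw [Finset.sum_comm]
        refine Finset.sum_congr rfl fun i _ => ?_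
        rw [Finset.mul_sum, ← Finset.sum_add_distrib, ← Finset.sum_add_distrib]
        refine Finset.sum_congr rfl fun t _ => ?_
        rw [lintegral_add_right _ (.of_discrete), lintegral_add_right _ (.of_discrete),
          lintegral_const_mul' _ _ (by simp)]
    _ ≤ _ := by
        gcongr with i _ t _
        · exact sum_lintegral_radius_le P O D i hL hT
        · exact lintegral_countsLaw_farSet_le P O h_trig hD t hL.le i

end

/-! ### Assembling the bound -/

/-- The exponential is at most T⁻², and each of the T factors t + 1 is at most T. -/
lemma sum_tail_le_one {T : ℕ} (hT : 0 < T) :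
    ∑ t ∈ Finset.range T, ENNReal.ofReal ((t + 1) * Real.exp (-(2 + 6 * Real.log T))) ≤ 1 := by
  have hT' : (1 : ℝ) ≤ T := by exact_mod_cast hT
  have hexp : Real.exp (-(2 + 6 * Real.log T)) ≤ ((T : ℝ) ^ 2)⁻¹ := by
    have hlog : 0 ≤ Real.log T := Real.log_nonneg hT'
    calc _ ≤ Real.exp (-(Real.log ((T : ℝ) ^ 2))) := by
          rw [Real.exp_le_exp, Real.log_pow]
          push_cast
          linarith
      _ = _ := by rw [Real.exp_neg, Real.exp_log (by positivity)]
  calc _ ≤ ∑ _t ∈ Finset.range T, ENNReal.ofReal (T * ((T : ℝ) ^ 2)⁻¹) := by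
        refine Finset.sum_le_sum fun t ht => ENNReal.ofReal_le_ofReal ?_
        have : (t : ℝ) + 1 ≤ T := by exact_mod_cast Finset.mem_range.1 ht
        gcongr
    _ = 1 := by
        rw [Finset.sum_const, Finset.card_range, nsmul_eq_mul, ← ENNReal.ofReal_natCast,
          ← ENNReal.ofReal_mul (by positivity)]
        have : (T : ℝ) * (T * ((T : ℝ) ^ 2)⁻¹) = 1 := by field_simp
        rw [this, ENNReal.ofReal_one]

lemma bayesRegret_le (P : Problem m) {r : Finset (Fin m) → Cube m → ℝ} (O : P.Oracle r)
    {prior : Measure (Env m)} [IsProbabilityMeasure prior]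
    {B : ℝ} (hB : 0 < B) (h_lipschitz : P.LipschitzReward r B)
    (h_trig : P.TriggersThroughBinaryArms) (h_class : ∀ᵐ D ∂prior, D ∈ P.envs)
    (h_uniform : prior.map meanVec = volume) {T : ℕ} (hT : 0 < T) :
    bayesRegret P O prior T ≤ ENNReal.ofReal B * (m *
      (2 * (ENNReal.ofReal (2 * √(T * (2 + 6 * Real.log T))) *
        ∫⁻ D, ((P.minProb D)⁻¹) ^ (1 / 2 : ℝ) ∂prior + ∫⁻ D, (P.minProb D)⁻¹ ∂prior) + 2)) := by
  set L : ℝ := 2 + 6 * Real.log T with hL_def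
  have hL : 0 < L := by
    have : 0 ≤ Real.log T := Real.log_natCast_nonneg T
    positivity
  have hfar : ∀ i t, AEMeasurable (fun D => ∫⁻ c, (farSet L c i).indicator 1 (meanVec D)
      ∂(countsLaw P O D t)) prior := fun i t =>
    aemeasurable_lintegral_countsLaw P O h_trig h_class h_uniform t
      (G := fun c => (farSet L c i).indicator 1)
      fun c => measurable_one.indicator (measurableSet_farSet L c i)
  have hp : AEMeasurable (fun D => (P.minProb D)⁻¹) prior :=
    (aemeasurable_minProb P h_trig h_class h_uniform).inv
  have hmain : AEMeasurable (fun D => 2 * (ENNReal.ofReal (2 * √(T * L)) *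
      ((P.minProb D)⁻¹) ^ (1 / 2 : ℝ) + (P.minProb D)⁻¹) +
        ∑ t ∈ Finset.range T, ENNReal.ofReal ((t + 1) * Real.exp (-L))) prior :=
    ((((hp.pow_const _).const_mul _).add hp).const_mul _).add_const _
  have hsum : ∀ i, AEMeasurable (fun D => (2 * (ENNReal.ofReal (2 * √(T * L)) *
      ((P.minProb D)⁻¹) ^ (1 / 2 : ℝ) + (P.minProb D)⁻¹) +
        ∑ t ∈ Finset.range T, ENNReal.ofReal ((t + 1) * Real.exp (-L))) +
        ∑ t ∈ Finset.range T, ∫⁻ c, (farSet L c i).indicator 1 (meanVec D)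
          ∂(countsLaw P O D t)) prior := fun i =>
    hmain.add (Finset.aemeasurable_fun_sum _ fun t _ => hfar i t)
  calc bayesRegret P O prior T
      ≤ ∫⁻ D, ∑ t ∈ Finset.range T, ∫⁻ c, ∫⁻ θ,
        ENNReal.ofReal |r (O.toFun θ) θ - r (O.toFun θ) (meanVec D)| ∂(sampleKernel m c)
          ∂(countsLaw P O D t) ∂prior :=
        bayesRegret_le_lintegral P O hB h_lipschitz h_trig h_class h_uniform T
    _ ≤ ∫⁻ D, ENNReal.ofReal B * ∑ i, ((2 * (ENNReal.ofReal (2 * √(T * L)) *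
        ((P.minProb D)⁻¹) ^ (1 / 2 : ℝ) + (P.minProb D)⁻¹) +
          ∑ t ∈ Finset.range T, ENNReal.ofReal ((t + 1) * Real.exp (-L))) +
          ∑ t ∈ Finset.range T, ∫⁻ c, (farSet L c i).indicator 1 (meanVec D)
            ∂(countsLaw P O D t)) ∂prior := by
        refine lintegral_mono_ae ?_
        filter_upwards [h_class] with D hD
        exact sum_lintegral_abs_reward_sub_le P O hB h_lipschitz h_trig hD hL hT
    _ = ENNReal.ofReal B * ∑ i, ((2 * (ENNReal.ofReal (2 * √(T * L)) *
        ∫⁻ D, ((P.minProb D)⁻¹) ^ (1 / 2 : ℝ) ∂prior + ∫⁻ D, (P.minProb D)⁻¹ ∂prior) +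
          ∑ t ∈ Finset.range T, ENNReal.ofReal ((t + 1) * Real.exp (-L))) +
          ∑ t ∈ Finset.range T, ∫⁻ D, ∫⁻ c, (farSet L c i).indicator 1 (meanVec D)
            ∂(countsLaw P O D t) ∂prior) := by
        rw [lintegral_const_mul' _ _ ENNReal.ofReal_ne_top, lintegral_finsetSum' _ fun i _ => hsum i]
        congr 1
        refine Finset.sum_congr rfl fun i _ => ?_
        rw [lintegral_add_left' hmain, lintegral_finsetSum' _ fun t _ => hfar i t,
          lintegral_add_right _ measurable_const, lintegral_const_mul' _ _ (by simp),
          lintegral_add_right' _ hp, lintegral_const_mul' _ _ ENNReal.ofReal_ne_top,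
          lintegral_const, measure_univ, mul_one]
    _ ≤ ENNReal.ofReal B * ∑ _i : Fin m, ((2 * (ENNReal.ofReal (2 * √(T * L)) *
        ∫⁻ D, ((P.minProb D)⁻¹) ^ (1 / 2 : ℝ) ∂prior + ∫⁻ D, (P.minProb D)⁻¹ ∂prior) + 1) + 1) := by
        gcongr with i
        · exact sum_tail_le_one hT
        · exact (Finset.sum_le_sum fun t _ => lintegral_lintegral_farSet_le P O h_trig h_class
            h_uniform t hL.le i).trans (sum_tail_le_one hT)
    _ = _ := by
        rw [Finset.sum_const, Finset.card_univ, Fintype.card_fin, nsmul_eq_mul, add_assoc,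
          one_add_one_eq_two]

end CMAB

end

theorem theorem2 {m : ℕ} (P : CMAB.Problem m) (r : Finset (Fin m) → CMAB.Cube m → ℝ)
    (h_reward : P.ExpectedReward r)
    (B : ℝ) (hB : 0 < B) (h_lipschitz : P.LipschitzReward r B)
    (h_monotone : P.MonotoneReward r)
    (h_trig : P.TriggersThroughBinaryArms)
    (O : P.Oracle r)
    (prior : Measure (CMAB.Env m)) [IsProbabilityMeasure prior]
    (h_class : ∀ᵐ D ∂prior, D ∈ P.envs)
    (h_uniform : prior.map CMAB.meanVec = volume)
    (T : ℕ) (ρ : ℝ) (hρ : ρ ∈ Set.Ioo (0 : ℝ) 1) :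
    CMAB.bayesRegret P O prior T ≤
      ENNReal.ofReal (4 * m * B * √(T * (2 + 6 * Real.log T) / (1 - ρ))) *
          ∫⁻ D, ((P.minProb D)⁻¹) ^ (1 / 2 : ℝ) ∂prior
        + ENNReal.ofReal (8 * (m : ℝ) ^ 2 * B) *
          (1 + ENNReal.ofReal (1 / ρ ^ 2) * ∫⁻ D, (P.minProb D)⁻¹ ∂prior) := by
  rcases Nat.eq_zero_or_pos T with rfl | hT
  · simp [CMAB.bayesRegret, CMAB.regret]
  obtain ⟨hρ0, hρ1⟩ := hρ
  have hlog : 0 ≤ Real.log T := Real.log_natCast_nonneg T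
  refine (CMAB.bayesRegret_le P O hB h_lipschitz h_trig h_class h_uniform hT).trans ?_
  set u := ∫⁻ D, ((P.minProb D)⁻¹) ^ (1 / 2 : ℝ) ∂prior
  set v := ∫⁻ D, (P.minProb D)⁻¹ ∂prior
  have h1 : ENNReal.ofReal (4 * m * B * √(T * (2 + 6 * Real.log T))) ≤
      ENNReal.ofReal (4 * m * B * √(T * (2 + 6 * Real.log T) / (1 - ρ))) := by
    refine ENNReal.ofReal_le_ofReal ?_
    gcongr
    rw [le_div_iff₀ (by linarith)]
    exact mul_le_of_le_one_right (by positivity) (by linarith)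
  have h2 : (1 : ℝ≥0∞) ≤ ENNReal.ofReal (1 / ρ ^ 2) := by
    rw [← ENNReal.ofReal_one]
    refine ENNReal.ofReal_le_ofReal ?_
    rw [le_div_iff₀ (by positivity), one_mul]
    exact pow_le_one₀ hρ0.le hρ1.le
  have h3 : ENNReal.ofReal (2 * m * B) ≤ ENNReal.ofReal (8 * (m : ℝ) ^ 2 * B) := by
    refine ENNReal.ofReal_le_ofReal ?_
    have h4 : (m : ℝ) ≤ (m : ℝ) ^ 2 := by exact_mod_cast Nat.le_self_pow two_ne_zero m
    have h5 := mul_le_mul_of_nonneg_right h4 hB.le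
    have h6 : (0 : ℝ) ≤ (m : ℝ) ^ 2 * B := by positivity
    linarith
  calc _ = ENNReal.ofReal (4 * m * B * √(T * (2 + 6 * Real.log T))) * u +
        ENNReal.ofReal (2 * m * B) * (1 + 1 * v) := by
        have e1 : (4 * m * B * √(T * (2 + 6 * Real.log T)) : ℝ) =
            B * (m * (2 * (2 * √(T * (2 + 6 * Real.log T))))) := by ring
        have e2 : (2 * m * B : ℝ) = B * (m * 2) := by ring
        rw [e1, e2]
        generalize 2 * √(T * (2 + 6 * Real.log T)) = s
        rw [ENNReal.ofReal_mul hB.le, ENNReal.ofReal_mul (Nat.cast_nonneg m),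
          ENNReal.ofReal_mul zero_le_two, ENNReal.ofReal_mul hB.le,
          ENNReal.ofReal_mul (Nat.cast_nonneg m), ENNReal.ofReal_natCast, ENNReal.ofReal_ofNat]
        ring
    _ ≤ _ := by gcongr
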